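/- Let $H=\mathbf C\times\mathbf R$ be the $3$-dimensional Heisenberg group, with the multiplication $(z_1,t_1)(z_2,t_2)=\bigl(z_1+z_2,\;t_1+t_2+\tfrac12\operatorname{Im}(z_1\overline{z_2})\bigr)$, and let $p:H\to\mathbf C$, $p(z,t)=z$. For a topological group $G$, let $\mathcal C(G)$ be the set of closed subgroups of $G$ with the Chabauty topology, that is, the topology generated by the sets $\{C : C\cap K=\emptyset\}$ for $K\subset G$ compact and $\{C : C\cap U\neq\emptyset\}$ for $U\subset G$ open. Let $\mathcal L(\mathbf C)\subset\mathcal C(\mathbf C)$ be the subspace of lattices of $\mathbf C$ (subgroups generated by an $\mathbf R$-basis of $\mathbf C$). A lattice in $H$ is a discrete subgroup $\Lambda$ such that $H/\Lambda$ has an $H$-invariant Borel probability measure; for $n\ge 1$ let $\mathcal L_n(H)\subset\mathcal C(H)$ be the subspace of lattices $\Lambda$ in $H$ whose commutator subgroup $[\Lambda,\Lambda]$ has index $n$ in the centre $Z(\Lambda)$. Let $\operatorname{Aut}(H)$ be the group of automorphisms of the topological group $H$, with the topology of uniform convergence on compact sets of automorphisms and of their inverses; it acts on $\mathcal C(H)$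 by $(\varphi,C)\mapsto\varphi(C)$. The topological group $\operatorname{Aut}(H)$ is a Lie group of dimension $6$. For every $n\ge1$: (i) for every $\Lambda\in\mathcal L_n(H)$, the projection $p(\Lambda)$ is a lattice in $\mathbf C$, and the map $\mathcal L_n(H)\to\mathcal L(\mathbf C)$, $\Lambda\mapsto p(\Lambda)$, is a locally trivial bundle whose fibre is the torus $(\mathbf R/\mathbf Z)^2$; (ii) $\mathcal L_n(H)$ is non-empty, and it is a homogeneous space of $\operatorname{Aut}(H)$ by a discrete subgroup: for every $\Lambda_0\in\mathcal L_n(H)$, the stabilizer $\Gamma=\{\varphi\in\operatorname{Aut}(H) : \varphi(\Lambda_0)=\Lambda_0\}$ is a discrete subgroup of $\operatorname{Aut}(H)$, and $\varphi\Gamma\mapsto\varphi(\Lambda_0)$ is a well-defined homeomorphism from $\operatorname{Aut}(H)/\Gamma$ onto $\mathcal L_n(H)$. Moreover, for all $n,n'\ge1$, the spaces $\mathcal L_n(H)$ and $\mathcal L_{n'}(H)$ are homeomorphic, and the torus bundles $\mathcal L_n(H)\to\mathcal L(\mathbf C)$ and $\mathcal L_{n'}(H)\to\mathcal L(\mathbf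 C)$ are isomorphic: there is a homeomorphism $f:\mathcal L_n(H)\to\mathcal L_{n'}(H)$ with $p(f(\Lambda))=p(\Lambda)$ for all $\Lambda\in\mathcal L_n(H)$. -/

import Mathlib

open Topology
open scoped Manifold ContDiff

/-! ### The Chabauty topology -/

/-- The Chabauty topology on the set of closed subsets of a topological space `X`, generated by the
sets `{F | F ∩ K = ∅}` with `K` compact and `{F | F ∩ U ≠ ∅}` with `U` open. -/
@[reducible]
def chabautyTopology (X : Type*) [TopologicalSpace X] :
    TopologicalSpace (TopologicalSpace.Closeds X) :=
  TopologicalSpace.generateFrom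
    ({O | ∃ K : Set X, IsCompact K ∧ O = {F : TopologicalSpace.Closeds X | (F : Set X) ∩ K = ∅}} ∪
      {O | ∃ U : Set X, IsOpen U ∧ O = {F : TopologicalSpace.Closeds X | ((F : Set X) ∩ U).Nonempty}})

/-- The space of closed subgroups of `G`, with the Chabauty topology. -/
instance ClosedSubgroup.instChabauty (G : Type*) [Group G] [TopologicalSpace G] :
    TopologicalSpace (ClosedSubgroup G) :=
  (chabautyTopology G).induced fun C => ⟨(C : Set G), C.isClosed'⟩

/-- The space of closed subgroups of an additive group `G`, with the Chabauty topology. -/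
instance ClosedAddSubgroup.instChabauty (G : Type*) [AddGroup G] [TopologicalSpace G] :
    TopologicalSpace (ClosedAddSubgroup G) :=
  (chabautyTopology G).induced fun C => ⟨(C : Set G), C.isClosed'⟩

/-! ### Lattices -/

/-- A lattice in `G` is a discrete subgroup `Γ` such that `G ⧸ Γ` has a `G`-invariant Borel
probability measure. -/
def IsLattice {G : Type*} [Group G] [TopologicalSpace G] (Γ : Subgroup G) : Prop :=
  DiscreteTopology Γ ∧
    ∃ μ : @MeasureTheory.Measure (G ⧸ Γ) (borel (G ⧸ Γ)), μ Set.univ = 1 ∧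
      ∀ (g : G) (s : Set (G ⧸ Γ)), @MeasurableSet (G ⧸ Γ) (borel (G ⧸ Γ)) s →
        μ ((fun x => g • x) ⁻¹' s) = μ s

/-- The space of lattices in `ℂ` (subgroups generated by an `ℝ`-basis of `ℂ`), a subspace of the
space of closed subgroups of `ℂ`. -/
abbrev ComplexLattice : Type :=
  {L : ClosedAddSubgroup ℂ //
    ∃ b : Module.Basis (Fin 2) ℝ ℂ, L.toAddSubgroup = AddSubgroup.closure (Set.range b)}

/-! ### The Heisenberg group -/

/-- The 3-dimensional Heisenberg group, modelled on `ℂ × ℝ`. -/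
@[ext]
structure Heisenberg where
  /-- The projection to `ℂ`. -/
  z : ℂ
  /-- The central coordinate. -/
  t : ℝ

namespace Heisenberg

/-- The topology of `ℂ × ℝ`. -/
noncomputable instance : TopologicalSpace Heisenberg :=
  TopologicalSpace.induced (fun g => (g.z, g.t)) (instTopologicalSpaceProd : TopologicalSpace (ℂ × ℝ))

/-- The law `(z₁, t₁) (z₂, t₂) = (z₁ + z₂, t₁ + t₂ + Im (z₁ * conj z₂) / 2)`. -/
noncomputable instance : Mul Heisenberg :=
  ⟨fun g h => ⟨g.z + h.z, g.t + h.t + (1 / 2) * (g.z * (starRingEnd ℂ) h.z).im⟩⟩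

noncomputable instance : One Heisenberg := ⟨⟨0, 0⟩⟩

noncomputable instance : Inv Heisenberg := ⟨fun g => ⟨-g.z, -g.t⟩⟩

theorem mul_def (g h : Heisenberg) :
    g * h = ⟨g.z + h.z, g.t + h.t + (1 / 2) * (g.z * (starRingEnd ℂ) h.z).im⟩ := rfl

theorem one_def : (1 : Heisenberg) = ⟨0, 0⟩ := rfl

theorem inv_def (g : Heisenberg) : g⁻¹ = ⟨-g.z, -g.t⟩ := rfl

noncomputable instance : Group Heisenberg :=
  Group.ofLeftAxioms
    (fun a b c => by
      simp only [mul_def, Heisenberg.mk.injEq]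
      refine ⟨by ring, ?_⟩
      simp only [Complex.mul_im, Complex.add_re, Complex.add_im, Complex.conj_re, Complex.conj_im]
      ring)
    (fun a => by simp [mul_def, one_def])
    (fun a => by
      simp only [mul_def, one_def, inv_def, Heisenberg.mk.injEq]
      refine ⟨by ring, ?_⟩
      simp only [Complex.mul_im, Complex.neg_re, Complex.neg_im, Complex.conj_re, Complex.conj_im]
      ring)

end Heisenberg

/-- The space of lattices `Λ` in the Heisenberg group whose commutator subgroup has index `n` in
the centre of `Λ`, a subspace of the space of closed subgroups. -/
abbrev HeisenbergLattice (n : ℕ) : Type :=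
  {Λ : ClosedSubgroup Heisenberg // IsLattice Λ.toSubgroup ∧
    (commutator Λ.toSubgroup).relIndex (Subgroup.center Λ.toSubgroup) = n}

/-! ### Automorphisms of a topological group -/

namespace ContinuousMulEquiv

variable {G : Type*} [Group G] [TopologicalSpace G]

/-- The group of automorphisms of the topological group `G`, under composition. -/
instance instGroupAut : Group (G ≃ₜ* G) where
  mul φ ψ := ψ.trans φ
  one := ContinuousMulEquiv.refl G
  inv φ := φ.symm
  mul_assoc _ _ _ := rfl
  one_mul _ := rfl
  mul_one _ := rfl
  inv_mul_cancel φ := ContinuousMulEquiv.ext fun x => φ.symm_apply_apply x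

/-- The standard topology on the automorphism group of a locally compact group: the compact-open
topology on an automorphism together with its inverse. -/
instance instTopologicalSpaceAut : TopologicalSpace (G ≃ₜ* G) :=
  TopologicalSpace.induced
    (fun φ => ((⟨φ, φ.continuous⟩, ⟨φ.symm, φ.symm.continuous⟩) : C(G, G) × C(G, G)))
    (instTopologicalSpaceProd : TopologicalSpace (C(G, G) × C(G, G)))

/-- The action of automorphisms on closed subgroups by direct image. -/
instance instMulActionClosedSubgroup : MulAction (G ≃ₜ* G) (ClosedSubgroup G) where
  smul φ C := ⟨C.toSubgroup.map φ.toMulEquiv.toMonoidHom,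
    φ.toHomeomorph.isClosedMap _ C.isClosed'⟩
  one_smul C := SetLike.coe_injective (Set.image_id (C : Set G))
  mul_smul φ ψ C := SetLike.coe_injective (Set.image_comp φ ψ (C : Set G))

end ContinuousMulEquiv

/-! ### Torus bundles -/

/-- The 2-dimensional torus `ℝ² / ℤ²`. -/
abbrev Torus : Type := UnitAddCircle × UnitAddCircle

/-- `π` is the projection of a torus bundle: a locally trivial bundle with fibre the torus. -/
def IsTorusBundle {E B : Type*} [TopologicalSpace E] [TopologicalSpace B] (π : E → B) : Prop :=
  ∀ b : B, ∃ e : Bundle.Trivialization Torus π, b ∈ e.baseSet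

/-! ### The Heisenberg group as a topological group -/

namespace Heisenberg

/-- The area form `Im (z * conj w)` on `ℂ`. -/
def area (z w : ℂ) : ℝ := z.im * w.re - z.re * w.im

theorem area_def (z w : ℂ) : area z w = z.im * w.re - z.re * w.im := rfl

@[simp] theorem mul_z (g h : Heisenberg) : (g * h).z = g.z + h.z := rfl

@[simp] theorem mul_t (g h : Heisenberg) : (g * h).t = g.t + h.t + area g.z h.z / 2 := by
  simp [mul_def, area]; ring

@[simp] theorem one_z : (1 : Heisenberg).z = 0 := rfl

@[simp] theorem one_t : (1 : Heisenberg).t = 0 := rfl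

@[simp] theorem inv_z (g : Heisenberg) : g⁻¹.z = -g.z := rfl

@[simp] theorem inv_t (g : Heisenberg) : g⁻¹.t = -g.t := rfl

/-- The underlying space of the Heisenberg group is `ℂ × ℝ`. -/
noncomputable def prodHomeo : Heisenberg ≃ₜ ℂ × ℝ where
  toFun g := (g.z, g.t)
  invFun x := ⟨x.1, x.2⟩
  continuous_toFun := continuous_induced_dom
  continuous_invFun := continuous_induced_rng.2 continuous_id

@[fun_prop]
theorem continuous_z : Continuous z := continuous_fst.comp prodHomeo.continuous

@[fun_prop]
theorem continuous_t : Continuous t := continuous_snd.comp prodHomeo.continuous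

theorem continuous_mk {X : Type*} [TopologicalSpace X] {f : X → ℂ} {g : X → ℝ}
    (hf : Continuous f) (hg : Continuous g) : Continuous fun x => (⟨f x, g x⟩ : Heisenberg) :=
  continuous_induced_rng.2 (hf.prodMk hg)

@[fun_prop]
theorem continuous_area {X : Type*} [TopologicalSpace X] {f g : X → ℂ}
    (hf : Continuous f) (hg : Continuous g) : Continuous fun x => area (f x) (g x) := by
  unfold area; fun_prop

instance : IsTopologicalGroup Heisenberg where
  continuous_mul := by
    have : (fun p : Heisenberg × Heisenberg => p.1 * p.2) =
        fun p => ⟨p.1.z + p.2.z, p.1.t + p.2.t + area p.1.z p.2.z / 2⟩ := by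
      ext p <;> simp
    rw [this]
    exact continuous_mk (by fun_prop) (by fun_prop)
  continuous_inv := continuous_mk (by fun_prop) (by fun_prop)

instance : T2Space Heisenberg := prodHomeo.symm.t2Space

instance : LocallyCompactSpace Heisenberg :=
  prodHomeo.isClosedEmbedding.locallyCompactSpace

end Heisenberg

open Heisenberg

/-! ### Frames of `ℂ` -/

/-- The ordered `ℝ`-bases of `ℂ`. -/
abbrev Frame : Type := {w : ℂ × ℂ // area w.1 w.2 ≠ 0}

namespace Frame

/-- The signed area of the parallelogram spanned by a frame. -/
def det (w : Frame) : ℝ := area w.1.1 w.1.2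

theorem det_ne_zero (w : Frame) : w.det ≠ 0 := w.2

@[fun_prop]
theorem continuous_det : Continuous det := by unfold det; fun_prop

/-- The linear map that sends the frame `(I, 1)` to `w`. -/
noncomputable def lin (w : Frame) (z : ℂ) : ℂ := z.im * w.1.1 + z.re * w.1.2

/-- The linear map that sends the frame `w` to `(I, 1)`. -/
noncomputable def coords (w : Frame) (z : ℂ) : ℂ :=
  ⟨area w.1.1 z / w.det, area z w.1.2 / w.det⟩

@[simp] theorem lin_add (w : Frame) (z z' : ℂ) : w.lin (z + z') = w.lin z + w.lin z' := by
  simp [lin]; ring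

@[simp] theorem lin_zero (w : Frame) : w.lin 0 = 0 := by simp [lin]

theorem area_lin (w : Frame) (z z' : ℂ) : area (w.lin z) (w.lin z') = w.det * area z z' := by
  simp [lin, area, det]; ring

@[simp] theorem coords_lin (w : Frame) (z : ℂ) : w.coords (w.lin z) = z := by
  have h := w.det_ne_zero
  apply Complex.ext <;> simp only [coords] <;> rw [div_eq_iff h] <;>
    simp [lin, area, det] <;> ring

@[simp] theorem lin_coords (w : Frame) (z : ℂ) : w.lin (w.coords z) = z := by
  have h := w.det_ne_zero
  apply Complex.ext <;> simp [coords, lin] <;> field_simp <;> simp [area, det] <;> ring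

theorem lin_injective (w : Frame) : Function.Injective w.lin :=
  Function.LeftInverse.injective w.coords_lin

theorem continuous_lin : Continuous fun p : Frame × ℂ => p.1.lin p.2 := by
  unfold lin; fun_prop

theorem continuous_coords : Continuous fun p : Frame × ℂ => p.1.coords p.2 := by
  have h : Continuous fun p : Frame × ℂ => Complex.equivRealProdCLM.symm
      (area p.1.1.1 p.2 / p.1.det, area p.2 p.1.1.2 / p.1.det) := by
    refine Complex.equivRealProdCLM.symm.continuous.comp (Continuous.prodMk ?_ ?_)
    · exact Continuous.div (by fun_prop) (by fun_prop) fun p => p.1.det_ne_zero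
    · exact Continuous.div (by fun_prop) (by fun_prop) fun p => p.1.det_ne_zero
  convert h using 2 with p
  apply Complex.ext <;> simp [coords]

@[simp] theorem lin_I (w : Frame) : w.lin Complex.I = w.1.1 := by simp [lin]

@[simp] theorem lin_one (w : Frame) : w.lin 1 = w.1.2 := by simp [lin]

end Frame

/-! ### The automorphism group of the Heisenberg group -/

/-- The parameter space of the automorphism group: a frame and a real linear form. -/
abbrev AutParam : Type := Frame × ℝ × ℝ

namespace AutParam

/-- The linear form with coefficients given by the parameter. -/
def form (x : AutParam) (z : ℂ) : ℝ := x.2.1 * z.im + x.2.2 * z.re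

@[simp] theorem form_add (x : AutParam) (z z' : ℂ) : x.form (z + z') = x.form z + x.form z' := by
  simp [form]; ring

@[fun_prop]
theorem continuous_form {X : Type*} [TopologicalSpace X] {f : X → AutParam} {g : X → ℂ}
    (hf : Continuous f) (hg : Continuous g) : Continuous fun x => (f x).form (g x) := by
  unfold form; fun_prop

/-- The action of a parameter on the Heisenberg group. -/
noncomputable def act (x : AutParam) (g : Heisenberg) : Heisenberg :=
  ⟨x.1.lin g.z, x.1.det * (g.t + x.form g.z)⟩

/-- The inverse of the action of a parameter on the Heisenberg group. -/
noncomputable def invAct (x : AutParam) (g : Heisenberg) : Heisenberg :=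
  ⟨x.1.coords g.z, g.t / x.1.det - x.form (x.1.coords g.z)⟩

theorem continuous_act : Continuous fun p : AutParam × Heisenberg => p.1.act p.2 := by
  refine continuous_mk ?_ ?_
  · exact Frame.continuous_lin.comp (f := fun p : AutParam × Heisenberg => (p.1.1, p.2.z))
      (by fun_prop)
  · fun_prop

theorem continuous_invAct : Continuous fun p : AutParam × Heisenberg => p.1.invAct p.2 := by
  have h : Continuous fun p : AutParam × Heisenberg => p.1.1.coords p.2.z :=
    Frame.continuous_coords.comp (f := fun p : AutParam × Heisenberg => (p.1.1, p.2.z))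
      (by fun_prop)
  refine continuous_mk h (Continuous.sub ?_ (by fun_prop))
  exact Continuous.div (by fun_prop) (by fun_prop) fun p => p.1.1.det_ne_zero

@[simp] theorem invAct_act (x : AutParam) (g : Heisenberg) : x.invAct (x.act g) = g := by
  ext <;> simp [act, invAct, x.1.det_ne_zero]

@[simp] theorem act_invAct (x : AutParam) (g : Heisenberg) : x.act (x.invAct g) = g := by
  have := x.1.det_ne_zero
  ext <;> simp [act, invAct]
  field_simp

/-- The automorphism of the Heisenberg group given by a parameter. -/
noncomputable def toAut (x : AutParam) : Heisenberg ≃ₜ* Heisenberg where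
  toFun := x.act
  invFun := x.invAct
  left_inv := x.invAct_act
  right_inv := x.act_invAct
  map_mul' g h := by
    ext
    · simp [act]
    · simp [act, Frame.area_lin]; ring
  continuous_toFun := continuous_act.comp (Continuous.prodMk_right x)
  continuous_invFun := continuous_invAct.comp (Continuous.prodMk_right x)

@[simp] theorem toAut_apply (x : AutParam) (g : Heisenberg) : x.toAut g = x.act g := rfl

theorem continuous_toAut : Continuous toAut := by
  refine continuous_induced_rng.2 (Continuous.prodMk ?_ ?_)
  · exact ContinuousMap.continuous_of_continuous_uncurry _ continuous_act
  · exact ContinuousMap.continuous_of_continuous_uncurry _ continuous_invAct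

end AutParam

namespace Heisenberg

theorem continuous_eval_aut (g : Heisenberg) :
    Continuous fun φ : Heisenberg ≃ₜ* Heisenberg => φ g := by
  have h : Continuous fun φ : Heisenberg ≃ₜ* Heisenberg =>
      ((⟨φ, φ.continuous⟩, ⟨φ.symm, φ.symm.continuous⟩) :
        C(Heisenberg, Heisenberg) × C(Heisenberg, Heisenberg)) := continuous_induced_dom
  have h' := (continuous_eval_const (F := C(Heisenberg, Heisenberg)) g).comp
    (continuous_fst.comp h)
  exact h'

theorem mem_center_iff (g : Heisenberg) : g ∈ Subgroup.center Heisenberg ↔ g.z = 0 := by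
  rw [Subgroup.mem_center_iff]
  constructor
  · intro h
    have h1 := congrArg t (h ⟨1, 0⟩)
    have h2 := congrArg t (h ⟨Complex.I, 0⟩)
    simp [area] at h1 h2
    apply Complex.ext <;> simp <;> linarith
  · intro h k
    ext <;> simp [h, area]; ring

theorem aut_z_eq_zero (φ : Heisenberg ≃ₜ* Heisenberg) {g : Heisenberg} (hg : g.z = 0) :
    (φ g).z = 0 := by
  rw [← mem_center_iff, Subgroup.mem_center_iff] at hg ⊢
  intro k
  simpa using congrArg φ (hg (φ.symm k))

theorem exists_toAut_eq (φ : Heisenberg ≃ₜ* Heisenberg) : ∃ x : AutParam, x.toAut = φ := by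
  have hcen : ∀ t : ℝ, (φ ⟨0, t⟩).z = 0 := fun t => aut_z_eq_zero φ rfl
  let c : ℝ →+ ℝ :=
    { toFun := fun t => (φ ⟨0, t⟩).t
      map_zero' := by
        change (φ 1).t = 0
        simp
      map_add' := fun s t => by
        have : (⟨0, s + t⟩ : Heisenberg) = ⟨0, s⟩ * ⟨0, t⟩ := by ext <;> simp [area]
        rw [this, map_mul, mul_t, hcen]
        simp [area] }
  have hc : Continuous c := continuous_t.comp
    (φ.continuous.comp (continuous_mk continuous_const continuous_id))
  have hcl : ∀ t, c t = c 1 * t := fun t => by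
    have := (c.toRealLinearMap hc).map_smul t 1
    simp only [smul_eq_mul, mul_one, AddMonoidHom.coe_toRealLinearMap] at this
    rw [this, mul_comm]
  have hmul : ∀ z w : ℂ, (⟨z + w, 0⟩ : Heisenberg) * ⟨0, area z w / 2⟩ = ⟨z, 0⟩ * ⟨w, 0⟩ := by
    intro z w; ext <;> simp [area]
  have hA : ∀ z w : ℂ, (φ ⟨z + w, 0⟩).z = (φ ⟨z, 0⟩).z + (φ ⟨w, 0⟩).z := fun z w => by
    have := congrArg (fun g => (φ g).z) (hmul z w)
    simpa [hcen] using this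
  let A : ℂ →+ ℂ :=
    { toFun := fun z => (φ ⟨z, 0⟩).z
      map_zero' := by
        change (φ 1).z = 0
        simp
      map_add' := hA }
  have hAc : Continuous A := continuous_z.comp
    (φ.continuous.comp (continuous_mk continuous_id continuous_const))
  have hAl : ∀ z, A z = z.im * A Complex.I + z.re * A 1 := fun z => by
    have h1 := (A.toRealLinearMap hAc).map_add (z.im • Complex.I) (z.re • 1)
    rw [map_smul, map_smul] at h1
    simp only [AddMonoidHom.coe_toRealLinearMap, Complex.real_smul, mul_one] at h1
    rw [← h1]
    congr 1
    apply Complex.ext <;> simp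
  have hAarea : ∀ z w, area (A z) (A w) = area (A Complex.I) (A 1) * area z w := fun z w => by
    rw [hAl z, hAl w]; simp [area]; ring
  have hm : ∀ z w : ℂ, (φ ⟨z + w, 0⟩).t + c 1 * (area z w / 2) =
      (φ ⟨z, 0⟩).t + (φ ⟨w, 0⟩).t + area (A Complex.I) (A 1) * area z w / 2 := fun z w => by
    have h1 := congrArg (fun g => (φ g).t) (hmul z w)
    simp only [map_mul, mul_t, hcen] at h1
    rw [← hAarea, ← hcl]
    change _ + (φ ⟨0, _⟩).t = _ + area (φ _).z (φ _).z / 2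
    rw [← h1]
    simp [area]
  have hdet : c 1 = area (A Complex.I) (A 1) := by
    have h1 := hm Complex.I 1
    have h2 := hm 1 Complex.I
    rw [add_comm 1 Complex.I] at h2
    simp [area] at h1 h2 ⊢
    linarith
  have hc1 : c 1 ≠ 0 := fun h => by
    have h2 : c (φ.symm ⟨0, 1⟩).t = 1 := by
      have h3 : (⟨0, (φ.symm ⟨0, 1⟩).t⟩ : Heisenberg) = φ.symm ⟨0, 1⟩ :=
        Heisenberg.ext (aut_z_eq_zero φ.symm rfl).symm rfl
      change (φ ⟨0, _⟩).t = 1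
      rw [h3]
      simp
    rw [hcl, h] at h2
    simp at h2
  let μ : ℂ →+ ℝ :=
    { toFun := fun z => (φ ⟨z, 0⟩).t
      map_zero' := by
        change (φ 1).t = 0
        simp
      map_add' := fun z w => by
        have := hm z w
        rw [hdet] at this
        linarith }
  have hμc : Continuous μ := continuous_t.comp
    (φ.continuous.comp (continuous_mk continuous_id continuous_const))
  have hμl : ∀ z, μ z = z.im * μ Complex.I + z.re * μ 1 := fun z => by
    have h1 := (μ.toRealLinearMap hμc).map_add (z.im • Complex.I) (z.re • 1)
    rw [map_smul, map_smul] at h1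
    simp only [AddMonoidHom.coe_toRealLinearMap, Complex.real_smul, mul_one, smul_eq_mul] at h1
    rw [← h1]
    congr 1
    apply Complex.ext <;> simp
  refine ⟨(⟨(A Complex.I, A 1), hdet ▸ hc1⟩, μ Complex.I / c 1, μ 1 / c 1), ?_⟩
  ext g
  all_goals
    have hg : g = ⟨g.z, 0⟩ * ⟨0, g.t⟩ := by ext <;> simp [area]
    have hφ : φ g = φ ⟨g.z, 0⟩ * φ ⟨0, g.t⟩ := by rw [← map_mul, ← hg]
    rw [hφ]
  · rw [mul_z, hcen, add_zero]
    exact (hAl g.z).symm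
  · rw [mul_t, hcen]
    change area (A Complex.I) (A 1) * (g.t + (μ Complex.I / c 1 * g.z.im + μ 1 / c 1 * g.z.re)) =
      μ g.z + c g.t + area (A g.z) 0 / 2
    rw [← hdet, hcl g.t, hμl g.z]
    simp only [area, Complex.zero_re, Complex.zero_im]
    field_simp
    ring

theorem toAut_injective : Function.Injective AutParam.toAut := by
  intro x y h
  have h1 := DFunLike.congr_fun h ⟨Complex.I, 0⟩
  have h2 := DFunLike.congr_fun h ⟨1, 0⟩
  have hw : x.1 = y.1 := by
    apply Subtype.ext
    have h3 : x.1.lin Complex.I = y.1.lin Complex.I := congrArg z h1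
    have h4 : x.1.lin 1 = y.1.lin 1 := congrArg z h2
    simp only [Frame.lin_I, Frame.lin_one] at h3 h4
    exact Prod.ext h3 h4
  have h3 := congrArg t h1
  have h4 := congrArg t h2
  have h0 := y.1.det_ne_zero
  simp [AutParam.act, hw, AutParam.form, h0] at h3 h4
  exact Prod.ext hw (Prod.ext h3 h4)

/-- The automorphism group of the Heisenberg group is parametrized by frames and linear forms. -/
noncomputable def autHomeo : AutParam ≃ₜ (Heisenberg ≃ₜ* Heisenberg) := by
  let e : AutParam ≃ (Heisenberg ≃ₜ* Heisenberg) :=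
    Equiv.ofBijective AutParam.toAut ⟨toAut_injective, exists_toAut_eq⟩
  have key : ∀ φ, ((e.symm φ).1.1 = ((φ ⟨Complex.I, 0⟩).z, (φ ⟨1, 0⟩).z)) ∧
      (e.symm φ).2.1 = (φ ⟨Complex.I, 0⟩).t / (e.symm φ).1.det ∧
      (e.symm φ).2.2 = (φ ⟨1, 0⟩).t / (e.symm φ).1.det := by
    intro φ
    obtain ⟨x, rfl⟩ := e.surjective φ
    have h0 := x.1.det_ne_zero
    have : ∀ g, (e x) g = x.act g := fun _ => rfl
    simp [this, AutParam.act, AutParam.form, h0]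
  refine ⟨e, AutParam.continuous_toAut, ?_⟩
  have hfr : Continuous fun φ => (e.symm φ).1 := by
    refine continuous_induced_rng.2 ?_
    refine ((continuous_z.comp (continuous_eval_aut ⟨Complex.I, 0⟩)).prodMk
      (continuous_z.comp (continuous_eval_aut ⟨1, 0⟩))).congr fun φ => ((key φ).1).symm
  have hd : Continuous fun φ => (e.symm φ).1.det := Frame.continuous_det.comp hfr
  refine hfr.prodMk (Continuous.prodMk ?_ ?_)
  · exact ((continuous_t.comp (continuous_eval_aut ⟨Complex.I, 0⟩)).div hd
      fun φ => (e.symm φ).1.det_ne_zero).congr fun φ => ((key φ).2.1).symm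
  · exact ((continuous_t.comp (continuous_eval_aut ⟨1, 0⟩)).div hd
      fun φ => (e.symm φ).1.det_ne_zero).congr fun φ => ((key φ).2.2).symm

@[simp] theorem autHomeo_apply (x : AutParam) : autHomeo x = x.toAut := rfl

end Heisenberg

/-! ### The Lie group structure of the automorphism group -/

namespace Heisenberg

/-- Real coordinates on `(ℂ × ℂ) × ℝ × ℝ`. -/
noncomputable def realCoords : (ℂ × ℂ) × ℝ × ℝ ≃ₜ EuclideanSpace ℝ (Fin 6) where
  toFun x := !₂[x.1.1.re, x.1.1.im, x.1.2.re, x.1.2.im, x.2.1, x.2.2]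
  invFun p := ((Complex.equivRealProdCLM.symm (p 0, p 1), Complex.equivRealProdCLM.symm (p 2, p 3)),
    p 4, p 5)
  left_inv x := by
    refine Prod.ext (Prod.ext ?_ ?_) (Prod.ext ?_ ?_)
    · exact Complex.equivRealProdCLM.symm_apply_apply x.1.1
    · exact Complex.equivRealProdCLM.symm_apply_apply x.1.2
    all_goals simp
  right_inv p := by
    ext i; fin_cases i <;> simp
  continuous_toFun := by
    refine (PiLp.continuous_toLp 2 _).comp (continuous_pi fun i => ?_)
    fin_cases i <;> simp <;> fun_prop
  continuous_invFun := by fun_prop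

/-- The global chart of the automorphism group. -/
noncomputable def autChart (φ : Heisenberg ≃ₜ* Heisenberg) : EuclideanSpace ℝ (Fin 6) :=
  !₂[(φ ⟨Complex.I, 0⟩).z.re, (φ ⟨Complex.I, 0⟩).z.im, (φ ⟨1, 0⟩).z.re, (φ ⟨1, 0⟩).z.im,
    (φ ⟨Complex.I, 0⟩).t / area (φ ⟨Complex.I, 0⟩).z (φ ⟨1, 0⟩).z,
    (φ ⟨1, 0⟩).t / area (φ ⟨Complex.I, 0⟩).z (φ ⟨1, 0⟩).z]

theorem autChart_toAut (x : AutParam) :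
    autChart x.toAut = realCoords (x.1.1, x.2) := by
  have h : area x.1.1.1 x.1.1.2 ≠ 0 := x.1.2
  ext i
  fin_cases i <;> simp [autChart, realCoords, AutParam.act, AutParam.form, Frame.det, h]

theorem isOpenEmbedding_autChart : IsOpenEmbedding autChart := by
  have h1 : IsOpen {w : ℂ × ℂ | area w.1 w.2 ≠ 0} :=
    isOpen_ne_fun (by fun_prop) continuous_const
  have h2 : IsOpenEmbedding fun x : AutParam => ((x.1.1, x.2) : (ℂ × ℂ) × ℝ × ℝ) :=
    h1.isOpenEmbedding_subtypeVal.prodMap .id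
  have h3 := (realCoords.isOpenEmbedding.comp h2).comp autHomeo.symm.isOpenEmbedding
  convert h3 using 1
  ext1 φ
  obtain ⟨x, rfl⟩ := autHomeo.surjective φ
  simp only [Function.comp_apply, autHomeo.symm_apply_apply]
  exact autChart_toAut x

/-- The determinant of the frame given by real coordinates. -/
def coordDet (p : EuclideanSpace ℝ (Fin 6)) : ℝ := p 1 * p 2 - p 0 * p 3

theorem coordDet_autChart_ne_zero (φ : Heisenberg ≃ₜ* Heisenberg) :
    coordDet (autChart φ) ≠ 0 := by
  obtain ⟨x, rfl⟩ := autHomeo.surjective φ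
  have h : area x.1.1.1 x.1.1.2 ≠ 0 := x.1.2
  simpa [autChart_toAut, coordDet, realCoords, area] using h

/-- The multiplication of the automorphism group in the global chart. -/
noncomputable def coordMul (p q : EuclideanSpace ℝ (Fin 6)) : EuclideanSpace ℝ (Fin 6) :=
  !₂[q 1 * p 0 + q 0 * p 2, q 1 * p 1 + q 0 * p 3, q 3 * p 0 + q 2 * p 2, q 3 * p 1 + q 2 * p 3,
    q 4 + (p 4 * q 1 + p 5 * q 0) / coordDet q, q 5 + (p 4 * q 3 + p 5 * q 2) / coordDet q]

/-- The inversion of the automorphism group in the global chart. -/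
noncomputable def coordInv (p : EuclideanSpace ℝ (Fin 6)) : EuclideanSpace ℝ (Fin 6) :=
  !₂[-p 0 / coordDet p, p 2 / coordDet p, p 1 / coordDet p, -p 3 / coordDet p,
    -(p 4 * p 2 - p 5 * p 0), p 4 * p 3 - p 5 * p 1]

theorem autChart_mul (φ ψ : Heisenberg ≃ₜ* Heisenberg) :
    autChart (φ * ψ) = coordMul (autChart φ) (autChart ψ) := by
  obtain ⟨x, rfl⟩ := autHomeo.surjective φ
  obtain ⟨y, rfl⟩ := autHomeo.surjective ψ
  have h : ∀ g, (x.toAut * y.toAut) g = x.act (y.act g) := fun _ => rfl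
  have hd : coordDet (realCoords (y.1.1, y.2)) = y.1.det := by
    simp [coordDet, realCoords, area, Frame.det]
  have hx := x.1.det_ne_zero
  have hy := y.1.det_ne_zero
  simp only [autHomeo_apply, autChart_toAut]
  ext i
  unfold coordMul
  rw [hd]
  unfold autChart
  have hD : area y.1.1.1 y.1.1.2 = y.1.det := rfl
  simp only [h, AutParam.act, Frame.area_lin, Frame.lin_I, Frame.lin_one, hD]
  fin_cases i <;> simp [realCoords, AutParam.form, Frame.lin]
  all_goals field_simp

theorem autChart_inv (φ : Heisenberg ≃ₜ* Heisenberg) :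
    autChart φ⁻¹ = coordInv (autChart φ) := by
  obtain ⟨x, rfl⟩ := autHomeo.surjective φ
  have hx := x.1.det_ne_zero
  have h : ∀ g, (x.toAut)⁻¹ g = x.invAct g := fun _ => rfl
  have hd : coordDet (realCoords (x.1.1, x.2)) = x.1.det := by
    simp [coordDet, realCoords, area, Frame.det]
  have ha : area (x.1.coords Complex.I) (x.1.coords 1) = 1 / x.1.det := by
    have := x.1.area_lin (x.1.coords Complex.I) (x.1.coords 1)
    rw [x.1.lin_coords, x.1.lin_coords] at this
    rw [eq_div_iff hx, mul_comm, ← this]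
    simp [area]
  simp only [autHomeo_apply, autChart_toAut]
  ext i
  unfold coordInv
  rw [hd]
  unfold autChart
  simp only [h, AutParam.invAct, ha]
  fin_cases i <;> simp [realCoords, AutParam.form, Frame.coords, area_def] <;> field_simp
  all_goals ring

theorem contDiffAt_coordMul {x : EuclideanSpace ℝ (Fin 6) × EuclideanSpace ℝ (Fin 6)}
    (hx : coordDet x.2 ≠ 0) {n : WithTop ℕ∞} :
    ContDiffAt ℝ n (fun x : EuclideanSpace ℝ (Fin 6) × EuclideanSpace ℝ (Fin 6) =>
      coordMul x.1 x.2) x := by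
  have hd : ContDiffAt ℝ n (fun x : EuclideanSpace ℝ (Fin 6) × EuclideanSpace ℝ (Fin 6) =>
      coordDet x.2) x := by unfold coordDet; fun_prop
  rw [contDiffAt_euclidean]
  intro i
  fin_cases i <;> simp [coordMul] <;> fun_prop (disch := assumption)

theorem contDiffAt_coordInv {x : EuclideanSpace ℝ (Fin 6)} (hx : coordDet x ≠ 0)
    {n : WithTop ℕ∞} : ContDiffAt ℝ n coordInv x := by
  have hd : ContDiffAt ℝ n coordDet x := by unfold coordDet; fun_prop
  rw [contDiffAt_euclidean]
  intro i
  fin_cases i <;> simp [coordInv] <;> fun_prop (disch := assumption)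

/-- The automorphism group of the Heisenberg group is a manifold with one chart. -/
@[reducible]
noncomputable def autChartedSpace :
    ChartedSpace (EuclideanSpace ℝ (Fin 6)) (Heisenberg ≃ₜ* Heisenberg) :=
  isOpenEmbedding_autChart.singletonChartedSpace

theorem lieGroup_aut :
    @LieGroup ℝ _ (EuclideanSpace ℝ (Fin 6)) _ (EuclideanSpace ℝ (Fin 6)) _ _ (𝓡 6) ∞
      (Heisenberg ≃ₜ* Heisenberg) _ _ autChartedSpace := by
  let := autChartedSpace
  have hι : ContMDiff (𝓡 6) (𝓡 6) ∞ autChart :=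
    contMDiff_isOpenEmbedding isOpenEmbedding_autChart
  have hman : IsManifold (𝓡 6) ∞ (Heisenberg ≃ₜ* Heisenberg) :=
    isOpenEmbedding_autChart.isManifold_singleton
  refine { hman with contMDiff_mul := ?_, contMDiff_inv := ?_ }
  · refine ContMDiff.of_comp_isOpenEmbedding isOpenEmbedding_autChart ?_
    intro p
    have h1 := (contDiffAt_coordMul (n := ∞) (x := (autChart p.1, autChart p.2))
      (coordDet_autChart_ne_zero p.2)).contMDiffAt
    have h2 : ContMDiffAt ((𝓡 6).prod (𝓡 6))
        𝓘(ℝ, EuclideanSpace ℝ (Fin 6) × EuclideanSpace ℝ (Fin 6)) ∞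
        (fun p : (Heisenberg ≃ₜ* Heisenberg) × (Heisenberg ≃ₜ* Heisenberg) =>
        (autChart p.1, autChart p.2)) p :=
      ContMDiffAt.prodMk_space (hι.comp contMDiff_fst).contMDiffAt
        (hι.comp contMDiff_snd).contMDiffAt
    refine (h1.comp p h2).congr_of_eventuallyEq (Filter.Eventually.of_forall fun q => ?_)
    exact autChart_mul q.1 q.2
  · refine ContMDiff.of_comp_isOpenEmbedding isOpenEmbedding_autChart ?_
    intro φ
    have h1 := (contDiffAt_coordInv (n := ∞) (coordDet_autChart_ne_zero φ)).contMDiffAt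
    refine (h1.comp φ hι.contMDiffAt).congr_of_eventuallyEq
      (Filter.Eventually.of_forall fun ψ => ?_)
    exact autChart_inv ψ

instance : IsTopologicalGroup (Heisenberg ≃ₜ* Heisenberg) :=
  letI := autChartedSpace
  haveI := lieGroup_aut
  topologicalGroup_of_lieGroup (𝓡 6) ∞

end Heisenberg

/-! ### Families of closed sets in the Chabauty topology -/

section Chabauty

variable {W X : Type*} [TopologicalSpace W] [TopologicalSpace X]

/-- The images of a closed set under a continuous family of homeomorphisms depend continuously on
the parameter. -/
theorem continuous_chabauty_image {act inv : W → X → X} (hl : ∀ w x, inv w (act w x) = x)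
    (hr : ∀ w x, act w (inv w x) = x) (hact : ∀ x, Continuous fun w => act w x)
    (hinv : Continuous fun p : W × X => inv p.1 p.2) (C : TopologicalSpace.Closeds X)
    {F : W → TopologicalSpace.Closeds X} (hF : ∀ w, (F w : Set X) = act w '' C) :
    @Continuous _ _ _ (chabautyTopology X) F := by
  refine continuous_generateFrom_iff.2 ?_
  rintro O (⟨K, hK, rfl⟩ | ⟨U, hU, rfl⟩)
  · rw [isOpen_iff_eventually]
    intro w hw
    have h1 : ∀ k ∈ K, inv w k ∉ C := fun k hk hC => by
      have : k ∈ (F w : Set X) ∩ K := ⟨by rw [hF]; exact ⟨_, hC, hr w k⟩, hk⟩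
      rw [hw] at this
      exact this
    have h2 : ∀ᶠ w' in 𝓝 w, ∀ k ∈ K, inv w' k ∉ C :=
      hK.eventually_forall_of_forall_eventually fun k hk =>
        (C.isClosed.isOpen_compl.preimage hinv).mem_nhds (h1 k hk)
    filter_upwards [h2] with w' hw'
    refine Set.eq_empty_of_forall_notMem ?_
    rintro k ⟨hk1, hk⟩
    rw [hF] at hk1
    obtain ⟨c, hc, rfl⟩ := hk1
    exact hw' _ hk (by rwa [hl])
  · have : F ⁻¹' {F | ((F : Set X) ∩ U).Nonempty} = ⋃ c ∈ C, {w | act w c ∈ U} := by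
      ext w
      simp only [Set.mem_preimage, Set.mem_ofPred_eq, hF, Set.mem_iUnion]
      constructor
      · rintro ⟨_, ⟨c, hc, rfl⟩, hU⟩
        exact ⟨c, hc, hU⟩
      · rintro ⟨c, hc, hU⟩
        exact ⟨_, ⟨c, hc, rfl⟩, hU⟩
    rw [this]
    exact isOpen_biUnion fun c _ => hU.preimage (hact c)

/-- If the pair `(act w₀ x, act w₀ y)` of points of a closed set `C` can be moved freely by changing
`w₀` slightly, and if `act w₀` moves the compact set `K` off `C`, then for every closed set near `C`
there is a parameter near `w₀` with the same properties. -/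
theorem eventually_exists_param [LocallyCompactSpace X] {act : W → X → X}
    (hact : Continuous fun p : W × X => act p.1 p.2) {w₀ : W} {x y : X}
    (hev : 𝓝 (act w₀ x, act w₀ y) ≤ (𝓝 w₀).map fun w => (act w x, act w y))
    {C : TopologicalSpace.Closeds X} (hx : act w₀ x ∈ C) (hy : act w₀ y ∈ C) {K : Set X}
    (hK : IsCompact K) (hKC : ∀ k ∈ K, act w₀ k ∉ C) {V : Set W} (hV : V ∈ 𝓝 w₀) :
    ∀ᶠ F in @nhds _ (chabautyTopology X) C,
      ∃ w ∈ V, act w x ∈ F ∧ act w y ∈ F ∧ ∀ k ∈ K, act w k ∉ F := by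
  let := chabautyTopology X
  have h1 : IsCompact (act w₀ '' K) :=
    hK.image (hact.comp (Continuous.prodMk_right w₀))
  obtain ⟨K', hK', hKK', hK'C⟩ := exists_compact_between h1 C.isClosed.isOpen_compl (by
    rintro _ ⟨k, hk, rfl⟩
    exact hKC k hk)
  have h2 : ∀ᶠ w in 𝓝 w₀, ∀ k ∈ K, act w k ∈ interior K' :=
    hK.eventually_forall_of_forall_eventually fun k hk =>
      (isOpen_interior.preimage hact).mem_nhds (hKK' ⟨k, hk, rfl⟩)
  have h3 := hev (Filter.image_mem_map (Filter.inter_mem hV h2))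
  obtain ⟨U₁, U₂, hU₁, hxU, hU₂, hyU, hU⟩ := mem_nhds_prod_iff'.1 h3
  have o1 : IsOpen {F : TopologicalSpace.Closeds X | (F : Set X) ∩ K' = ∅} :=
    TopologicalSpace.isOpen_generateFrom_of_mem (Or.inl ⟨K', hK', rfl⟩)
  have o2 : ∀ U : Set X, IsOpen U →
      IsOpen {F : TopologicalSpace.Closeds X | ((F : Set X) ∩ U).Nonempty} := fun U hU =>
    TopologicalSpace.isOpen_generateFrom_of_mem (Or.inr ⟨U, hU, rfl⟩)
  filter_upwards [o1.mem_nhds (show (C : Set X) ∩ K' = ∅ from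
      (Set.disjoint_left.2 fun z hz hz' => hK'C hz' hz).inter_eq),
    (o2 _ hU₁).mem_nhds ⟨_, hx, hxU⟩, (o2 _ hU₂).mem_nhds ⟨_, hy, hyU⟩]
  rintro F hF ⟨p, hpF, hp⟩ ⟨q, hqF, hq⟩
  obtain ⟨w, ⟨hwV, hwK⟩, hw⟩ := hU (show (p, q) ∈ U₁ ×ˢ U₂ from ⟨hp, hq⟩)
  obtain ⟨rfl, rfl⟩ := Prod.ext_iff.1 hw
  refine ⟨w, hwV, hpF, hqF, fun k hk hkF => ?_⟩
  have : act w k ∈ (F : Set X) ∩ K' := ⟨hkF, interior_subset (hwK k hk)⟩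
  rw [hF] at this
  exact this

end Chabauty

/-! ### Lattices in `ℂ` -/

/-- The Gaussian integers, as a subset of `ℂ`. -/
def gaussianSet : Set ℂ := {z | (∃ k : ℤ, z.im = k) ∧ ∃ l : ℤ, z.re = l}

theorem isClosed_gaussianSet : IsClosed gaussianSet := by
  have h : gaussianSet = Complex.im ⁻¹' Set.range ((↑) : ℤ → ℝ) ∩
      Complex.re ⁻¹' Set.range ((↑) : ℤ → ℝ) := by
    ext z; simp [gaussianSet, eq_comm]
  rw [h]
  exact (Int.isClosedEmbedding_coe_real.isClosed_range.preimage Complex.continuous_im).inter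
    (Int.isClosedEmbedding_coe_real.isClosed_range.preimage Complex.continuous_re)

/-- The points of the square `[-1/2, 1/2]²` outside of the open square `(-1/4, 1/4)²`. -/
def squareAnnulus : Set ℂ := {z | max |z.re| |z.im| ≤ 1 / 2 ∧ 1 / 4 ≤ max |z.re| |z.im|}

theorem isCompact_squareAnnulus : IsCompact squareAnnulus := by
  refine Metric.isCompact_of_isClosed_isBounded ?_ ?_
  · have hc : Continuous fun z : ℂ => max |z.re| |z.im| := by fun_prop
    exact (isClosed_le hc continuous_const).inter (isClosed_le continuous_const hc)
  · refine (Metric.isBounded_iff_subset_closedBall 0).2 ⟨1, fun z hz => ?_⟩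
    have h := hz.1
    rw [max_le_iff] at h
    rw [mem_closedBall_zero_iff]
    exact (Complex.norm_le_abs_re_add_abs_im z).trans (by linarith)

theorem disjoint_gaussianSet_squareAnnulus {z : ℂ} (hz : z ∈ squareAnnulus) :
    z ∉ gaussianSet := by
  rintro ⟨⟨k, hk⟩, l, hl⟩
  obtain ⟨h1, h2⟩ := hz
  rw [hk, hl, max_le_iff, ← Int.cast_abs, ← Int.cast_abs] at h1
  have hk' : |k| < 1 := by
    have : ((|k| : ℤ) : ℝ) < (1 : ℤ) := by push_cast; push_cast at h1; linarith
    exact_mod_cast this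
  have hl' : |l| < 1 := by
    have : ((|l| : ℤ) : ℝ) < (1 : ℤ) := by push_cast; push_cast at h1; linarith
    exact_mod_cast this
  rw [Int.abs_lt_one_iff] at hk' hl'
  rw [hk, hl, hk', hl'] at h2
  norm_num at h2

/-- A subgroup of `ℂ` that contains the Gaussian integers and misses the annulus is the group of
Gaussian integers. -/
theorem mem_gaussianSet_of_disjoint {L : AddSubgroup ℂ} (hI : Complex.I ∈ L) (h1 : (1 : ℂ) ∈ L)
    (hL : ∀ z ∈ squareAnnulus, z ∉ L) {z : ℂ} (hz : z ∈ L) : z ∈ gaussianSet := by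
  set u : ℂ := z - ((round z.im) • Complex.I + (round z.re) • (1 : ℂ)) with hu
  have huL : u ∈ L := L.sub_mem hz (L.add_mem (L.zsmul_mem hI _) (L.zsmul_mem h1 _))
  have hre : u.re = z.re - round z.re := by simp [hu]
  have him : u.im = z.im - round z.im := by simp [hu]
  set M := max |u.re| |u.im| with hM
  have hM2 : M ≤ 1 / 2 := by
    rw [hM, hre, him]
    exact max_le (abs_sub_round _) (abs_sub_round _)
  have hscale : ∀ j : ℕ, max |((2 ^ j : ℕ) • u).re| |((2 ^ j : ℕ) • u).im| = 2 ^ j * M := by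
    intro j
    rw [hM, mul_max_of_nonneg _ _ (by positivity)]
    rw [Complex.smul_re, Complex.smul_im]
    simp [abs_mul]
  have hlt : ∀ j : ℕ, 2 ^ j * M < 1 / 4 := by
    have step : ∀ j : ℕ, 2 ^ j * M ≤ 1 / 2 → 2 ^ j * M < 1 / 4 := fun j hj => by
      by_contra! hcon
      refine hL ((2 ^ j : ℕ) • u) ?_ (L.nsmul_mem huL _)
      simp only [squareAnnulus, Set.mem_ofPred_eq, hscale]
      exact ⟨hj, hcon⟩
    intro j
    induction j with
    | zero => exact step 0 (by simpa using hM2)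
    | succ j ih => exact step _ (by rw [pow_succ]; linarith)
  have hM0 : M ≤ 0 := by
    by_contra! hpos
    obtain ⟨j, hj⟩ := pow_unbounded_of_one_lt (1 / M) (one_lt_two : (1 : ℝ) < 2)
    have h4 := hlt j
    rw [div_lt_iff₀ hpos] at hj
    linarith
  have h5 := (abs_nonpos_iff.1 ((le_max_left _ _).trans hM0))
  have h6 := (abs_nonpos_iff.1 ((le_max_right _ _).trans hM0))
  rw [hre] at h5
  rw [him] at h6
  exact ⟨⟨_, sub_eq_zero.1 h6⟩, _, sub_eq_zero.1 h5⟩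

namespace Frame

theorem mem_closure_iff (w : Frame) (z : ℂ) :
    z ∈ AddSubgroup.closure {w.1.1, w.1.2} ↔ w.coords z ∈ gaussianSet := by
  rw [AddSubgroup.mem_closure_pair]
  constructor
  · rintro ⟨k, l, rfl⟩
    have : k • w.1.1 + l • w.1.2 = w.lin ⟨l, k⟩ := by simp [lin]
    rw [this, coords_lin]
    exact ⟨⟨k, rfl⟩, l, rfl⟩
  · rintro ⟨⟨k, hk⟩, l, hl⟩
    refine ⟨k, l, ?_⟩
    conv_rhs => rw [← w.lin_coords z]
    simp [lin, hk, hl]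

/-- The basis of `ℂ` given by a frame. -/
theorem exists_basis (w : Frame) :
    ∃ b : Module.Basis (Fin 2) ℝ ℂ, Set.range b = {w.1.1, w.1.2} := by
  have hli : LinearIndependent ℝ ![w.1.1, w.1.2] := by
    rw [LinearIndependent.pair_iff]
    intro s t h
    have : w.lin ⟨t, s⟩ = w.lin 0 := by simpa [lin] using h
    have := w.lin_injective this
    rw [Complex.ext_iff] at this
    exact ⟨this.2, this.1⟩
  refine ⟨basisOfLinearIndependentOfCardEqFinrank hli (by simp), ?_⟩
  rw [coe_basisOfLinearIndependentOfCardEqFinrank]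
  simp [Matrix.range_cons, Set.pair_comm]

/-- The lattice spanned by a frame. -/
def lattice (w : Frame) : ComplexLattice :=
  ⟨⟨AddSubgroup.closure {w.1.1, w.1.2}, by
    have h : ((AddSubgroup.closure {w.1.1, w.1.2} : AddSubgroup ℂ) : Set ℂ) =
        w.coords ⁻¹' gaussianSet := Set.ext w.mem_closure_iff
    change IsClosed ((AddSubgroup.closure {w.1.1, w.1.2} : AddSubgroup ℂ) : Set ℂ)
    rw [h]
    exact isClosed_gaussianSet.preimage (continuous_coords.comp (Continuous.prodMk_right w))⟩, by
    obtain ⟨b, hb⟩ := w.exists_basis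
    exact ⟨b, by rw [hb]⟩⟩

theorem mem_lattice_iff (w : Frame) (z : ℂ) : z ∈ w.lattice.1 ↔ w.coords z ∈ gaussianSet :=
  w.mem_closure_iff z

theorem coe_lattice (w : Frame) : (w.lattice.1 : Set ℂ) = w.lin '' gaussianSet := by
  ext z
  refine (w.mem_lattice_iff z).trans ⟨fun h => ⟨_, h, w.lin_coords z⟩, ?_⟩
  rintro ⟨z, hz, rfl⟩
  rwa [coords_lin]

theorem lattice_surjective : Function.Surjective lattice := by
  rintro ⟨L, b, hb⟩
  have hli := b.linearIndependent
  have hrange : Set.range b = {b 0, b 1} := by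
    ext z; simp [Fin.exists_fin_two, eq_comm]
  have hdet : area (b 0) (b 1) ≠ 0 := fun h0 => by
    have e : ⇑b = ![b 0, b 1] := by ext i; fin_cases i <;> rfl
    rw [e, LinearIndependent.pair_iff] at hli
    rw [area_def] at h0
    have h1 := hli (b 1).re (-(b 0).re) (by
      apply Complex.ext
      · simp; ring
      · simp; linarith)
    have h2 := hli (b 1).im (-(b 0).im) (by
      apply Complex.ext
      · simp; linarith
      · simp; ring)
    exact b.ne_zero 0 (Complex.ext (neg_eq_zero.1 h1.2) (neg_eq_zero.1 h2.2))
  refine ⟨⟨(b 0, b 1), hdet⟩, ?_⟩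
  apply Subtype.ext
  apply SetLike.coe_injective
  change ((AddSubgroup.closure {b 0, b 1} : AddSubgroup ℂ) : Set ℂ) = (L.toAddSubgroup : Set ℂ)
  rw [hb, hrange]

theorem lattice_eq_of_mem {w : Frame} {L : ComplexLattice} (h1 : w.1.1 ∈ L.1) (h2 : w.1.2 ∈ L.1)
    (hL : ∀ z ∈ squareAnnulus, w.lin z ∉ L.1) : L = w.lattice := by
  apply Subtype.ext
  apply SetLike.coe_injective
  apply Set.Subset.antisymm
  · intro z hz
    refine (w.mem_lattice_iff z).2 ?_
    let f : ℂ →+ ℂ := ⟨⟨w.lin, w.lin_zero⟩, w.lin_add⟩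
    refine mem_gaussianSet_of_disjoint (L := L.1.toAddSubgroup.comap f) ?_ ?_ hL ?_
    · change w.lin Complex.I ∈ L.1
      rwa [lin_I]
    · change w.lin 1 ∈ L.1
      rwa [lin_one]
    · change w.lin (w.coords z) ∈ L.1
      rwa [lin_coords]
  · change AddSubgroup.closure {w.1.1, w.1.2} ≤ L.1.toAddSubgroup
    rw [AddSubgroup.closure_le]
    rintro z (rfl | rfl)
    · exact h1
    · exact h2

theorem isOpen_frames : IsOpen {w : ℂ × ℂ | area w.1 w.2 ≠ 0} :=
  isOpen_ne_fun (by fun_prop) continuous_const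

theorem continuous_lattice : Continuous lattice := by
  refine continuous_induced_rng.2 (continuous_induced_rng.2 ?_)
  refine continuous_chabauty_image (act := lin) (inv := coords) (fun w => w.coords_lin)
    (fun w => w.lin_coords) (fun z => continuous_lin.comp (Continuous.prodMk_left z))
    continuous_coords ⟨gaussianSet, isClosed_gaussianSet⟩ fun w => w.coe_lattice

theorem isOpenMap_lattice : IsOpenMap lattice := by
  refine IsOpenMap.of_nhds_le fun w₀ S hS => ?_
  have hev : 𝓝 (w₀.lin Complex.I, w₀.lin 1) ≤
      (𝓝 w₀).map fun w => (w.lin Complex.I, w.lin 1) := by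
    simp only [lin_I, lin_one]
    exact (isOpen_frames.isOpenEmbedding_subtypeVal.map_nhds_eq w₀).ge
  have hmem : ∀ {z : ℂ}, z ∈ gaussianSet → w₀.lin z ∈ w₀.lattice.1 := fun {z} hz => by
    rw [mem_lattice_iff, coords_lin]; exact hz
  let := chabautyTopology ℂ
  let toCl : ComplexLattice → TopologicalSpace.Closeds ℂ := fun L => ⟨(L.1 : Set ℂ), L.1.isClosed'⟩
  have htoCl : Continuous toCl := by
    have h : Continuous fun L : ClosedAddSubgroup ℂ =>
      (⟨(L : Set ℂ), L.isClosed'⟩ : TopologicalSpace.Closeds ℂ) := continuous_induced_dom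
    exact h.comp continuous_subtype_val
  have key := eventually_exists_param (C := toCl w₀.lattice) continuous_lin hev
    (hmem ⟨⟨1, by simp⟩, 0, by simp⟩) (hmem ⟨⟨0, by simp⟩, 1, by simp⟩) isCompact_squareAnnulus
    (fun z hz hz' => disjoint_gaussianSet_squareAnnulus hz
      (by simpa using (w₀.mem_lattice_iff _).1 hz')) hS
  filter_upwards [htoCl.tendsto _ key]
  rintro L ⟨w, hwS, h1, h2, hL⟩
  rw [lin_I] at h1
  rw [lin_one] at h2
  rw [lattice_eq_of_mem (L := L) h1 h2 hL]
  exact hwS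

/-- Frames of the same lattice are not close to each other. -/
theorem exists_injOn_lattice (w₀ : Frame) : ∃ V ∈ 𝓝 w₀, Set.InjOn lattice V := by
  let f : Frame × Frame → ℂ × ℂ := fun p => (p.1.coords p.2.1.1, p.1.coords p.2.1.2)
  have hf : Continuous f := by
    refine Continuous.prodMk ?_ ?_
    · exact continuous_coords.comp (f := fun p : Frame × Frame => (p.1, p.2.1.1)) (by fun_prop)
    · exact continuous_coords.comp (f := fun p : Frame × Frame => (p.1, p.2.1.2)) (by fun_prop)
  have hf0 : f (w₀, w₀) = (Complex.I, 1) := by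
    have h1 := w₀.coords_lin Complex.I
    have h2 := w₀.coords_lin 1
    rw [lin_I] at h1
    rw [lin_one] at h2
    simp [f, h1, h2]
  have hnear : ∀ {z z' : ℂ}, z ∈ gaussianSet → z' ∈ gaussianSet → dist z z' < 1 → z = z' := by
    rintro z z' ⟨⟨k, hk⟩, l, hl⟩ ⟨⟨k', hk'⟩, l', hl'⟩ h
    rw [dist_eq_norm] at h
    have h1 := (Complex.abs_re_le_norm _).trans_lt h
    have h2 := (Complex.abs_im_le_norm _).trans_lt h
    rw [Complex.sub_re, hl, hl'] at h1
    rw [Complex.sub_im, hk, hk'] at h2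
    have h3 : |l - l'| < 1 := by exact_mod_cast h1
    have h4 : |k - k'| < 1 := by exact_mod_cast h2
    rw [Int.abs_lt_one_iff, sub_eq_zero] at h3 h4
    exact Complex.ext (by rw [hl, hl', h3]) (by rw [hk, hk', h4])
  have hU : f ⁻¹' (Metric.ball Complex.I 1 ×ˢ Metric.ball 1 1) ∈ 𝓝 w₀ ×ˢ 𝓝 w₀ := by
    rw [← nhds_prod_eq]
    refine hf.continuousAt.preimage_mem_nhds ?_
    rw [hf0]
    exact prod_mem_nhds (Metric.ball_mem_nhds _ one_pos) (Metric.ball_mem_nhds _ one_pos)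
  obtain ⟨V, hV, hVU⟩ := Filter.mem_prod_same_iff.1 hU
  refine ⟨V, hV, fun w hw w' hw' h => ?_⟩
  obtain ⟨h1, h2⟩ := hVU (Set.mk_mem_prod hw hw')
  have hmem : ∀ z, z ∈ w'.lattice.1 → w.coords z ∈ gaussianSet := fun z hz => by
    rwa [← mem_lattice_iff, h]
  have e1 : w'.1.1 ∈ w'.lattice.1 := AddSubgroup.subset_closure (Or.inl rfl)
  have e2 : w'.1.2 ∈ w'.lattice.1 := AddSubgroup.subset_closure (Or.inr rfl)
  have h3 := hnear (hmem _ e1) ⟨⟨1, by simp⟩, 0, by simp⟩ h1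
  have h4 := hnear (hmem _ e2) ⟨⟨0, by simp⟩, 1, by simp⟩ h2
  have h5 := congrArg w.lin h3
  have h6 := congrArg w.lin h4
  rw [lin_coords, lin_I] at h5
  rw [lin_coords, lin_one] at h6
  exact Subtype.ext (Prod.ext h5.symm h6.symm)

end Frame

/-! ### Subgroups of the Heisenberg group over a lattice in `ℂ` -/

namespace Heisenberg

open scoped commutatorElement

/-- The central one-parameter subgroup. -/
noncomputable def central : Multiplicative ℝ →* Heisenberg where
  toFun t := ⟨0, t.toAdd⟩
  map_one' := rfl
  map_mul' s t := by ext <;> simp [area]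

@[simp] theorem central_z (t : Multiplicative ℝ) : (central t).z = 0 := rfl

@[simp] theorem central_t (t : Multiplicative ℝ) : (central t).t = t.toAdd := rfl

theorem central_injective : Function.Injective central := fun _ _ h => congrArg t h

theorem commutatorElement_eq (g h : Heisenberg) :
    ⁅g, h⁆ = central (Multiplicative.ofAdd (area g.z h.z)) := by
  ext
  · simp [commutatorElement_def]
  · simp [commutatorElement_def]
    simp [area]
    ring

theorem relIndex_zpowers_pow {G : Type*} [Group G] {g : G}
    (hg : Function.Injective fun k : ℤ => g ^ k) (n : ℕ) :
    (Subgroup.zpowers (g ^ n)).relIndex (Subgroup.zpowers g) = n := by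
  let f : Multiplicative ℤ →* G := zpowersHom G g
  have hf : Function.Injective f := hg
  have h1 : (Subgroup.zpowers (Multiplicative.ofAdd (n : ℤ))).map f = Subgroup.zpowers (g ^ n) := by
    rw [MonoidHom.map_zpowers]
    simp [f]
  have h2 : (⊤ : Subgroup (Multiplicative ℤ)).map f = Subgroup.zpowers g := by
    ext x
    simp [f, Subgroup.mem_zpowers_iff, Multiplicative.exists]
  rw [← h1, ← h2, Subgroup.relIndex_map_map_of_injective _ _ hf, Subgroup.relIndex_top_right]
  exact Int.index_zmultiples n

variable {Λ : Subgroup Heisenberg} {w : Frame}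

/-- A subgroup of the Heisenberg group lies over a frame if the frame spans its projection to
`ℂ`. -/
def LiesOver (Λ : Subgroup Heisenberg) (w : Frame) : Prop :=
  ∀ z, (∃ g ∈ Λ, g.z = z) ↔ w.coords z ∈ gaussianSet

theorem LiesOver.exists_fst (h : LiesOver Λ w) : ∃ g ∈ Λ, g.z = w.1.1 :=
  (h _).2 (by rw [← w.lin_I, w.coords_lin]; exact ⟨⟨1, by simp⟩, 0, by simp⟩)

theorem LiesOver.exists_snd (h : LiesOver Λ w) : ∃ g ∈ Λ, g.z = w.1.2 :=
  (h _).2 (by rw [← w.lin_one, w.coords_lin]; exact ⟨⟨0, by simp⟩, 1, by simp⟩)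

theorem LiesOver.map_center (h : LiesOver Λ w) :
    (Subgroup.center Λ).map Λ.subtype = (Λ.comap central).map central := by
  obtain ⟨a, ha, haz⟩ := h.exists_fst
  obtain ⟨b, hb, hbz⟩ := h.exists_snd
  ext g
  simp only [Subgroup.mem_map, Subgroup.mem_center_iff, Subgroup.mem_comap, Subgroup.coe_subtype]
  constructor
  · rintro ⟨⟨g, hg⟩, hc, rfl⟩
    have h1 := congrArg (fun x : Λ => (x : Heisenberg).t) (hc ⟨a, ha⟩)
    have h2 := congrArg (fun x : Λ => (x : Heisenberg).t) (hc ⟨b, hb⟩)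
    simp only [Subgroup.coe_mul, mul_t, haz, hbz] at h1 h2
    have hs : ∀ z w, area z w = - area w z := fun z w => by simp [area]; ring
    rw [hs w.1.1 g.z] at h1
    rw [hs w.1.2 g.z] at h2
    have h3 : area g.z w.1.1 = 0 := by linarith
    have h4 : area g.z w.1.2 = 0 := by linarith
    have h0 : g.z = 0 := by
      rw [← w.lin_coords g.z]
      have : w.coords g.z = 0 := by
        apply Complex.ext <;> simp [Frame.coords, h4, hs w.1.1 g.z, h3]
      rw [this, w.lin_zero]
    have : central (Multiplicative.ofAdd g.t) = g := Heisenberg.ext h0.symm rfl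
    exact ⟨Multiplicative.ofAdd g.t, by rwa [this], this⟩
  · rintro ⟨t, ht, rfl⟩
    refine ⟨⟨_, ht⟩, fun k => ?_, rfl⟩
    apply Subtype.ext
    ext <;> simp [area]
    ring

theorem LiesOver.map_commutator (h : LiesOver Λ w) :
    (commutator Λ).map Λ.subtype =
      (Subgroup.zpowers (Multiplicative.ofAdd w.det)).map central := by
  obtain ⟨a, ha, haz⟩ := h.exists_fst
  obtain ⟨b, hb, hbz⟩ := h.exists_snd
  rw [commutator_def, Subgroup.map_commutator, MonoidHom.map_zpowers]
  rw [← MonoidHom.range_eq_map, Subgroup.range_subtype]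
  apply le_antisymm
  · rw [Subgroup.commutator_le]
    intro g hg k hk
    obtain ⟨⟨m, hm⟩, l, hl⟩ := (h _).1 ⟨g, hg, rfl⟩
    obtain ⟨⟨m', hm'⟩, l', hl'⟩ := (h _).1 ⟨k, hk, rfl⟩
    refine ⟨m * l' - l * m', ?_⟩
    change central _ ^ (_ : ℤ) = _
    rw [commutatorElement_eq, ← map_zpow, ← w.lin_coords g.z, ← w.lin_coords k.z, w.area_lin,
      ← ofAdd_zsmul, area_def, hm, hl, hm', hl']
    refine congrArg (fun t => central (Multiplicative.ofAdd t)) ?_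
    push_cast [zsmul_eq_mul]
    ring
  · rw [Subgroup.zpowers_le]
    have := Subgroup.commutator_mem_commutator ha hb
    rwa [commutatorElement_eq, haz, hbz] at this

theorem LiesOver.relIndex_eq (h : LiesOver Λ w) :
    (commutator Λ).relIndex (Subgroup.center Λ) =
      (Subgroup.zpowers (Multiplicative.ofAdd w.det)).relIndex (Λ.comap central) := by
  rw [← Subgroup.relIndex_map_map_of_injective _ _ Λ.subtype_injective, h.map_center,
    h.map_commutator, Subgroup.relIndex_map_map_of_injective _ _ central_injective]

theorem zpowers_det_relIndex (w : Frame) {n : ℕ} (hn : 1 ≤ n) :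
    (Subgroup.zpowers (Multiplicative.ofAdd w.det)).relIndex
      (Subgroup.zpowers (Multiplicative.ofAdd (w.det / n))) = n := by
  have hn0 : (n : ℝ) ≠ 0 := by positivity
  have h1 : Multiplicative.ofAdd w.det = Multiplicative.ofAdd (w.det / n) ^ n := by
    rw [← ofAdd_nsmul, nsmul_eq_mul, mul_div_cancel₀ _ hn0]
  rw [h1]
  refine relIndex_zpowers_pow (fun k l hkl => ?_) n
  simp only [← ofAdd_zsmul] at hkl
  have h2 := Multiplicative.ofAdd.injective hkl
  simp only [zsmul_eq_mul] at h2
  exact_mod_cast mul_right_cancel₀ (div_ne_zero w.det_ne_zero hn0) h2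

theorem LiesOver.relIndex_eq_iff (h : LiesOver Λ w) {n : ℕ} (hn : 1 ≤ n) :
    (commutator Λ).relIndex (Subgroup.center Λ) = n ↔
      Λ.comap central = Subgroup.zpowers (Multiplicative.ofAdd (w.det / n)) := by
  have hn0 : (n : ℝ) ≠ 0 := by positivity
  rw [h.relIndex_eq]
  refine ⟨fun hi => ?_, fun hi => by rw [hi, zpowers_det_relIndex w hn]⟩
  have h1 : Subgroup.zpowers (Multiplicative.ofAdd w.det) ≤ Λ.comap central := by
    obtain ⟨a, ha, haz⟩ := h.exists_fst
    obtain ⟨b, hb, hbz⟩ := h.exists_snd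
    rw [Subgroup.zpowers_le, Subgroup.mem_comap]
    have : ⁅a, b⁆ ∈ Λ := Λ.mul_mem (Λ.mul_mem (Λ.mul_mem ha hb) (Λ.inv_mem ha)) (Λ.inv_mem hb)
    rwa [commutatorElement_eq, haz, hbz] at this
  have h2 : Λ.comap central ≤ Subgroup.zpowers (Multiplicative.ofAdd (w.det / n)) := by
    intro t ht
    have h3 := Subgroup.pow_index_mem
      ((Subgroup.zpowers (Multiplicative.ofAdd w.det)).subgroupOf (Λ.comap central)) ⟨t, ht⟩
    rw [← Subgroup.relIndex, hi, Subgroup.mem_subgroupOf] at h3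
    obtain ⟨k, hk⟩ := h3
    refine ⟨k, ?_⟩
    have h4 : (k : ℝ) * w.det = n * t.toAdd := by
      have := congrArg Multiplicative.toAdd hk
      simpa using this
    apply Multiplicative.toAdd.injective
    simp only [toAdd_zpow, toAdd_ofAdd, zsmul_eq_mul]
    rw [← mul_div_assoc, h4]
    field_simp
  refine le_antisymm h2 ?_
  have h5 := Subgroup.relIndex_mul_relIndex _ _ _ h1 h2
  rw [hi, zpowers_det_relIndex w hn] at h5
  exact Subgroup.relIndex_eq_one.1 (Nat.eq_of_mul_eq_mul_left hn (by rw [h5, mul_one]))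

/-- Two subgroups over the same frame coincide if they share lifts of the frame and their central
parts. -/
theorem LiesOver.le_of_mem {Λ' : Subgroup Heisenberg} (h : LiesOver Λ w) {a b : Heisenberg}
    (haz : a.z = w.1.1) (hbz : b.z = w.1.2) (ha : a ∈ Λ) (hb : b ∈ Λ)
    (ha' : a ∈ Λ') (hb' : b ∈ Λ') (hc : Λ.comap central ≤ Λ'.comap central) : Λ ≤ Λ' := by
  intro g hg
  obtain ⟨⟨k, hk⟩, l, hl⟩ := (h _).1 ⟨g, hg, rfl⟩
  have hz : ∀ (x : Heisenberg) (m : ℤ), (x ^ m).z = m * x.z := by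
    let f : Heisenberg →* Multiplicative ℂ :=
      ⟨⟨fun x => Multiplicative.ofAdd x.z, rfl⟩, fun _ _ => rfl⟩
    intro x m
    have := congrArg Multiplicative.toAdd (map_zpow f x m)
    simpa [f] using this
  set p := a ^ k * b ^ l with hp
  have hpz : p.z = g.z := by
    rw [hp, mul_z, hz, hz, haz, hbz, ← w.lin_coords g.z]
    simp [Frame.lin, hk, hl]
  have hpΛ : p ∈ Λ := Λ.mul_mem (Λ.zpow_mem ha _) (Λ.zpow_mem hb _)
  have hpΛ' : p ∈ Λ' := Λ'.mul_mem (Λ'.zpow_mem ha' _) (Λ'.zpow_mem hb' _)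
  have hq : central (Multiplicative.ofAdd (p⁻¹ * g).t) = p⁻¹ * g :=
    Heisenberg.ext (by simp [hpz]) rfl
  have h1 : p⁻¹ * g ∈ Λ' := by
    rw [← hq]
    exact hc (show central _ ∈ Λ by rw [hq]; exact Λ.mul_mem (Λ.inv_mem hpΛ) hg)
  simpa using Λ'.mul_mem hpΛ' h1

/-! ### The standard lattices -/

/-- The standard lattice in the Heisenberg group whose commutator subgroup has index `n` in its
centre. -/
noncomputable def stdLattice (n : ℕ) : Subgroup Heisenberg where
  carrier := {g | g.z ∈ gaussianSet ∧
    ∃ m : ℤ, n * (g.t - (g.z.im * g.z.re + g.z.im + g.z.re) / 2) = m}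
  one_mem' := ⟨⟨⟨0, by simp⟩, 0, by simp⟩, 0, by simp⟩
  mul_mem' := by
    rintro g h ⟨⟨⟨k, hk⟩, l, hl⟩, m, hm⟩ ⟨⟨⟨k', hk'⟩, l', hl'⟩, m', hm'⟩
    refine ⟨⟨⟨k + k', by simp [hk, hk']⟩, l + l', by simp [hl, hl']⟩, m + m' - n * l * k', ?_⟩
    push_cast
    rw [← hm, ← hm', mul_t, mul_z, area_def, Complex.add_im, Complex.add_re, hk, hl, hk', hl']
    ring
  inv_mem' := by
    rintro g ⟨⟨⟨k, hk⟩, l, hl⟩, m, hm⟩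
    refine ⟨⟨⟨-k, by simp [hk]⟩, -l, by simp [hl]⟩, -m - n * k * l, ?_⟩
    push_cast
    rw [← hm, inv_t, inv_z, Complex.neg_im, Complex.neg_re, hk, hl]
    ring

theorem mem_stdLattice {n : ℕ} {g : Heisenberg} : g ∈ stdLattice n ↔ g.z ∈ gaussianSet ∧
    ∃ m : ℤ, n * (g.t - (g.z.im * g.z.re + g.z.im + g.z.re) / 2) = m := Iff.rfl

theorem isClosed_stdLattice (n : ℕ) : IsClosed (stdLattice n : Set Heisenberg) := by
  have h : (stdLattice n : Set Heisenberg) = z ⁻¹' gaussianSet ∩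
      (fun g => n * (g.t - (g.z.im * g.z.re + g.z.im + g.z.re) / 2)) ⁻¹'
        Set.range ((↑) : ℤ → ℝ) := by
    ext g
    simp only [SetLike.mem_coe, mem_stdLattice, Set.mem_inter_iff, Set.mem_preimage, Set.mem_range,
      eq_comm]
  rw [h]
  exact (isClosed_gaussianSet.preimage continuous_z).inter
    (Int.isClosedEmbedding_coe_real.isClosed_range.preimage (by fun_prop))

/-- The standard lattice as a closed subgroup. -/
noncomputable def stdClosed (n : ℕ) : ClosedSubgroup Heisenberg :=
  ⟨stdLattice n, isClosed_stdLattice n⟩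

/-- The image of the standard lattice under the automorphism with a given parameter. -/
noncomputable def latticeOf (n : ℕ) (x : AutParam) : ClosedSubgroup Heisenberg :=
  x.toAut • stdClosed n

theorem coe_latticeOf (n : ℕ) (x : AutParam) :
    (latticeOf n x : Set Heisenberg) = x.act '' stdLattice n := rfl

theorem mem_latticeOf {n : ℕ} {x : AutParam} {g : Heisenberg} :
    g ∈ (latticeOf n x).toSubgroup ↔ x.invAct g ∈ stdLattice n := by
  change g ∈ (latticeOf n x : Set Heisenberg) ↔ _
  rw [coe_latticeOf]
  constructor
  · rintro ⟨g, hg, rfl⟩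
    rwa [AutParam.invAct_act]
  · intro h
    exact ⟨_, h, x.act_invAct g⟩

theorem act_mem_latticeOf {n : ℕ} {x : AutParam} {g : Heisenberg} :
    x.act g ∈ (latticeOf n x).toSubgroup ↔ g ∈ stdLattice n := by
  rw [mem_latticeOf, AutParam.invAct_act]

/-- The lift of `I` to the standard lattices. -/
noncomputable def liftI : Heisenberg := ⟨Complex.I, 1 / 2⟩

/-- The lift of `1` to the standard lattices. -/
noncomputable def liftOne : Heisenberg := ⟨1, 1 / 2⟩

theorem liftI_mem (n : ℕ) : liftI ∈ stdLattice n :=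
  ⟨⟨⟨1, by simp [liftI]⟩, 0, by simp [liftI]⟩, 0, by simp [liftI]⟩

theorem liftOne_mem (n : ℕ) : liftOne ∈ stdLattice n :=
  ⟨⟨⟨0, by simp [liftOne]⟩, 1, by simp [liftOne]⟩, 0, by simp [liftOne]⟩

theorem liesOver_latticeOf (n : ℕ) (x : AutParam) : LiesOver (latticeOf n x).toSubgroup x.1 := by
  intro z
  constructor
  · rintro ⟨g, hg, rfl⟩
    exact (mem_latticeOf.1 hg).1
  · intro h
    refine ⟨x.act ⟨x.1.coords z, ((x.1.coords z).im * (x.1.coords z).re + (x.1.coords z).im +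
      (x.1.coords z).re) / 2⟩, ?_, x.1.lin_coords z⟩
    rw [act_mem_latticeOf]
    exact ⟨h, 0, by simp⟩

theorem comap_central_latticeOf {n : ℕ} (hn : 1 ≤ n) (x : AutParam) :
    (latticeOf n x).toSubgroup.comap central =
      Subgroup.zpowers (Multiplicative.ofAdd (x.1.det / n)) := by
  have hn0 : (n : ℝ) ≠ 0 := by positivity
  have hd := x.1.det_ne_zero
  have h0 : x.1.coords 0 = 0 := by simpa using x.1.coords_lin 0
  ext t
  rw [Subgroup.mem_comap, mem_latticeOf, mem_stdLattice, Subgroup.mem_zpowers_iff]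
  simp only [AutParam.invAct, central_z, central_t, h0, AutParam.form]
  simp only [Complex.zero_im, Complex.zero_re, mul_zero, add_zero, sub_zero, zero_div]
  constructor
  · rintro ⟨-, m, hm⟩
    refine ⟨m, ?_⟩
    apply Multiplicative.toAdd.injective
    simp only [toAdd_zpow, toAdd_ofAdd, zsmul_eq_mul, ← hm]
    field_simp
  · rintro ⟨m, rfl⟩
    refine ⟨⟨⟨0, by simp⟩, 0, by simp⟩, m, ?_⟩
    simp only [toAdd_zpow, toAdd_ofAdd, zsmul_eq_mul]
    field_simp

theorem relIndex_latticeOf {n : ℕ} (hn : 1 ≤ n) (x : AutParam) :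
    (commutator (latticeOf n x).toSubgroup).relIndex
      (Subgroup.center (latticeOf n x).toSubgroup) = n :=
  ((liesOver_latticeOf n x).relIndex_eq_iff hn).2 (comap_central_latticeOf hn x)

theorem eq_latticeOf {n : ℕ} (hn : 1 ≤ n) {Λ : ClosedSubgroup Heisenberg} {x : AutParam}
    (h : LiesOver Λ.toSubgroup x.1)
    (hi : (commutator Λ.toSubgroup).relIndex (Subgroup.center Λ.toSubgroup) = n)
    (h1 : x.act liftI ∈ Λ.toSubgroup) (h2 : x.act liftOne ∈ Λ.toSubgroup) :
    Λ = latticeOf n x := by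
  have hc := (h.relIndex_eq_iff hn).1 hi
  rw [← comap_central_latticeOf hn x] at hc
  have h1' := (act_mem_latticeOf (x := x)).2 (liftI_mem n)
  have h2' := (act_mem_latticeOf (x := x)).2 (liftOne_mem n)
  have e1 : (x.act liftI).z = x.1.1.1 := x.1.lin_I
  have e2 : (x.act liftOne).z = x.1.1.2 := x.1.lin_one
  apply SetLike.coe_injective
  exact Set.Subset.antisymm
    (h.le_of_mem e1 e2 h1 h2 h1' h2' hc.le)
    ((liesOver_latticeOf n x).le_of_mem e1 e2 h1' h2' h1 h2 hc.ge)

end Heisenberg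

/-! ### The standard subgroups are lattices -/

section Lattice

open MeasureTheory
open scoped Pointwise

/-- A discrete subgroup with a fundamental domain of finite positive measure is a lattice. -/
theorem isLattice_of_isFundamentalDomain {G : Type*} [Group G] [TopologicalSpace G]
    [IsTopologicalGroup G] [MeasurableSpace G] [BorelSpace G] (ν : Measure G)
    [ν.IsMulLeftInvariant] [ν.IsMulRightInvariant] {Γ : Subgroup G} [Countable Γ.op]
    (hΓ : DiscreteTopology Γ) {F : Set G} (hF : IsFundamentalDomain Γ.op F ν) (h0 : ν F ≠ 0)
    (htop : ν F ≠ ⊤) : IsLattice Γ := by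
  refine ⟨hΓ, ?_⟩
  let _ : MeasurableSpace (G ⧸ Γ) := borel (G ⧸ Γ)
  have _ : BorelSpace (G ⧸ Γ) := ⟨rfl⟩
  have hπ : Measurable (QuotientGroup.mk : G → G ⧸ Γ) := continuous_quotient_mk'.measurable
  refine ⟨(ν F)⁻¹ • (ν.restrict F).map QuotientGroup.mk, ?_, fun g A hA => ?_⟩
  · rw [Measure.smul_apply, Measure.map_apply hπ MeasurableSet.univ, Set.preimage_univ,
      Measure.restrict_apply_univ, smul_eq_mul, ENNReal.inv_mul_cancel h0 htop]
  · have hg : Measurable fun x : G ⧸ Γ => g • x := (continuous_const_smul g).measurable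
    have hgF : IsFundamentalDomain Γ.op (g • F) ν := hF.smul_of_comm g
    rw [Measure.smul_apply, Measure.smul_apply, Measure.map_apply hπ hA,
      Measure.map_apply hπ (hg hA), Measure.restrict_apply (hπ hA),
      Measure.restrict_apply (hπ (hg hA))]
    congr 1
    have hinv : ∀ γ : Γ.op, (fun x : G => γ • x) ⁻¹' (QuotientGroup.mk ⁻¹' A : Set G) =
        (QuotientGroup.mk ⁻¹' A : Set G) := by
      rintro ⟨γ, hγ⟩
      ext x
      have : (QuotientGroup.mk (x * γ.unop) : G ⧸ Γ) = QuotientGroup.mk x :=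
        (QuotientGroup.mk_mul_of_mem x hγ)
      change (QuotientGroup.mk (x * γ.unop) : G ⧸ Γ) ∈ A ↔ _
      rw [this]
      rfl
    rw [hF.measure_set_eq hgF (hπ hA) hinv,
      ← measure_preimage_mul ν g (QuotientGroup.mk ⁻¹' A ∩ g • F)]
    congr 1
    ext x
    simp only [Set.mem_inter_iff, Set.mem_preimage, Set.mem_smul_set_iff_inv_smul_mem,
      smul_eq_mul, inv_mul_cancel_left]
    rfl

/-- The image of a lattice under an automorphism is a lattice. -/
theorem IsLattice.map {G : Type*} [Group G] [TopologicalSpace G] [IsTopologicalGroup G]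
    (φ : G ≃ₜ* G) {Γ : Subgroup G} (h : IsLattice Γ) : IsLattice (Γ.map φ.toMulEquiv.toMonoidHom) := by
  obtain ⟨hd, μ, hμ1, hμ⟩ := h
  have hmem : ∀ y : Γ.map φ.toMulEquiv.toMonoidHom, φ.symm y ∈ Γ := by
    rintro ⟨_, x, hx, rfl⟩
    change φ.symm (φ x) ∈ Γ
    simpa using hx
  refine ⟨DiscreteTopology.of_continuous_injective (f := fun y => (⟨φ.symm y, hmem y⟩ : Γ))
    (Continuous.subtype_mk (φ.symm.continuous.comp continuous_subtype_val) _) ?_, ?_⟩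
  · intro y y' hy
    exact Subtype.ext (φ.symm.injective (Subtype.ext_iff.1 hy))
  · let Γ' := Γ.map φ.toMulEquiv.toMonoidHom
    let _ : MeasurableSpace (G ⧸ Γ) := borel (G ⧸ Γ)
    have _ : BorelSpace (G ⧸ Γ) := ⟨rfl⟩
    let _ : MeasurableSpace (G ⧸ Γ') := borel (G ⧸ Γ')
    have _ : BorelSpace (G ⧸ Γ') := ⟨rfl⟩
    have hrel : Relator.LiftFun (QuotientGroup.leftRel Γ).r (QuotientGroup.leftRel Γ').r φ φ := by
      intro a b hab
      have hab' : a⁻¹ * b ∈ Γ := QuotientGroup.leftRel_apply.1 hab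
      refine QuotientGroup.leftRel_apply.2 ⟨_, hab', ?_⟩
      change φ (a⁻¹ * b) = _
      rw [map_mul, map_inv]
    let f : G ⧸ Γ → G ⧸ Γ' := Quotient.map' φ hrel
    have hf : Continuous f := φ.continuous.quotient_map' hrel
    have hequi : ∀ (g : G) (x : G ⧸ Γ), g • f x = f (φ.symm g • x) := by
      intro g x
      induction x using QuotientGroup.induction_on with
      | H x =>
        change (QuotientGroup.mk (g * φ x) : G ⧸ Γ') = QuotientGroup.mk (φ (φ.symm g * x))
        rw [map_mul, φ.apply_symm_apply]
    refine ⟨μ.map f, ?_, fun g A hA => ?_⟩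
    · rw [Measure.map_apply hf.measurable MeasurableSet.univ, Set.preimage_univ, hμ1]
    · have hfA := hf.measurable hA
      have hset : (fun x => g • f x) ⁻¹' A = (fun x => φ.symm g • x) ⁻¹' (f ⁻¹' A) := by
        ext x
        simp only [Set.mem_preimage, hequi]
      have hm : MeasurableSet ((fun x : G ⧸ Γ' => g • x) ⁻¹' A) :=
        (continuous_const_smul g).measurable hA
      rw [Measure.map_apply hf.measurable hA, Measure.map_apply hf.measurable hm,
        ← hμ (φ.symm g) _ hfA, ← hset]
      rfl

namespace Heisenberg

theorem discreteTopology_stdLattice {n : ℕ} (hn : 1 ≤ n) : DiscreteTopology (stdLattice n) := by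
  have hn0 : (n : ℝ) ≠ 0 := by positivity
  refine discreteTopology_of_isOpen_singleton_one ?_
  have ho : IsOpen {g : Heisenberg | |g.z.im| < 1 ∧ |g.z.re| < 1 ∧
      |n * (g.t - (g.z.im * g.z.re + g.z.im + g.z.re) / 2)| < 1} := by
    have hc1 : Continuous fun g : Heisenberg => |g.z.im| := by fun_prop
    have hc2 : Continuous fun g : Heisenberg => |g.z.re| := by fun_prop
    have hc3 : Continuous fun g : Heisenberg =>
      |n * (g.t - (g.z.im * g.z.re + g.z.im + g.z.re) / 2)| := by fun_prop
    exact (isOpen_lt hc1 continuous_const).inter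
      ((isOpen_lt hc2 continuous_const).inter (isOpen_lt hc3 continuous_const))
  convert ho.preimage (continuous_subtype_val (p := fun g => g ∈ stdLattice n)) using 1
  ext ⟨g, hg⟩
  simp only [Set.mem_singleton_iff, Set.mem_preimage]
  constructor
  · intro h
    have : g = 1 := congrArg Subtype.val h
    subst this
    simp
  · obtain ⟨⟨⟨k, hk⟩, l, hl⟩, m, hm⟩ := hg
    rintro ⟨h1, h2, h3⟩
    rw [hm] at h3
    rw [hk] at h1
    rw [hl] at h2
    have h1' : k = 0 := Int.abs_lt_one_iff.1 (by exact_mod_cast h1)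
    have h2' : l = 0 := Int.abs_lt_one_iff.1 (by exact_mod_cast h2)
    have h3' : m = 0 := Int.abs_lt_one_iff.1 (by exact_mod_cast h3)
    rw [hk, hl, h1', h2', h3'] at hm
    apply Subtype.ext
    apply Heisenberg.ext
    · apply Complex.ext <;> simp [hk, hl, h1', h2']
    · simpa [hn0] using hm

/-- The fundamental domain of the standard lattice. -/
def stdDomain (n : ℕ) : Set Heisenberg :=
  {g | (0 ≤ g.z.im ∧ g.z.im < 1) ∧ (0 ≤ g.z.re ∧ g.z.re < 1) ∧ (0 ≤ n * g.t ∧ n * g.t < 1)}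

theorem existsUnique_mul_mem_stdDomain {n : ℕ} (hn : 1 ≤ n) (g : Heisenberg) :
    ∃! γ : stdLattice n, g * γ ∈ stdDomain n := by
  have hn0 : (n : ℝ) ≠ 0 := by positivity
  set k : ℤ := -⌊g.z.im⌋ with hk
  set l : ℤ := -⌊g.z.re⌋ with hl
  set c : ℝ := n * (g.t + ((k : ℝ) * l + k + l) / 2 + area g.z ⟨l, k⟩ / 2) with hc
  have floor_iff : ∀ (x : ℝ) (j : ℤ), (0 ≤ x + j ∧ x + j < 1) ↔ j = -⌊x⌋ := fun x j => by
    rw [← neg_eq_iff_eq_neg, eq_comm, Int.floor_eq_iff]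
    push_cast
    constructor <;> rintro ⟨h1, h2⟩ <;> constructor <;> linarith
  have key : ∀ h : Heisenberg, ∀ m : ℤ, h.z = ⟨l, k⟩ →
      n * (h.t - (h.z.im * h.z.re + h.z.im + h.z.re) / 2) = m →
      n * (g * h).t = c + m := by
    intro h m hz hm
    rw [← hm, mul_t, hz, hc]
    ring
  refine ⟨⟨⟨⟨l, k⟩, (-⌊c⌋ : ℤ) / n + ((k : ℝ) * l + k + l) / 2⟩,
    ⟨⟨k, rfl⟩, l, rfl⟩, -⌊c⌋, by field_simp; ring⟩, ⟨?_, ?_, ?_⟩, ?_⟩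
  · exact (floor_iff _ _).2 hk
  · exact (floor_iff _ _).2 hl
  · rw [key _ (-⌊c⌋) rfl (by field_simp; ring)]
    exact (floor_iff _ _).2 rfl
  · rintro ⟨h, ⟨⟨k', hk'⟩, l', hl'⟩, m, hm⟩ ⟨h1, h2, h3⟩
    simp only [mul_z, Complex.add_im, Complex.add_re, hk', hl'] at h1 h2
    have e1 : k' = k := (floor_iff _ _).1 h1
    have e2 : l' = l := (floor_iff _ _).1 h2
    have hz : h.z = ⟨l, k⟩ := Complex.ext (by rw [hl', e2]) (by rw [hk', e1])
    simp only [key h m hz hm] at h3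
    have e3 : m = -⌊c⌋ := (floor_iff _ _).1 h3
    apply Subtype.ext
    refine Heisenberg.ext hz ?_
    change h.t = (-⌊c⌋ : ℤ) / n + ((k : ℝ) * l + k + l) / 2
    rw [← e3, ← hm, hz]
    field_simp
    ring

theorem isLattice_stdLattice {n : ℕ} (hn : 1 ≤ n) : IsLattice (stdLattice n) := by
  let _ : MeasurableSpace Heisenberg := borel Heisenberg
  have _ : BorelSpace Heisenberg := ⟨rfl⟩
  have hsm : Measurable prodHomeo.symm := prodHomeo.symm.continuous.measurable
  have _ : SecondCountableTopology Heisenberg := prodHomeo.secondCountableTopology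
  let ν : Measure Heisenberg := (volume : Measure (ℂ × ℝ)).map prodHomeo.symm
  have shear : ∀ (z : ℂ) (f : ℂ → ℝ), Continuous f →
      MeasurePreserving (fun p : ℂ × ℝ => (p.1 + z, p.2 + f p.1)) volume volume := by
    intro z f hf
    exact MeasurePreserving.skew_product (μa := (volume : Measure ℂ))
      (measurePreserving_add_right _ z) (g := fun x y => y + f x)
      (Continuous.measurable (by unfold Function.uncurry; fun_prop))
      (Filter.Eventually.of_forall fun x => map_add_right_eq_self _ (f x))
  have inv : ∀ (T : Heisenberg → Heisenberg) (z : ℂ) (f : ℂ → ℝ), Continuous f →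
      (∀ x, T x = ⟨x.z + z, x.t + f x.z⟩) → ν.map T = ν := by
    intro T z f hf hT
    have hTc : Continuous T := by
      rw [funext hT]
      exact continuous_mk (by fun_prop) (by fun_prop)
    change (Measure.map _ _).map T = Measure.map _ _
    rw [Measure.map_map hTc.measurable hsm]
    have : T ∘ prodHomeo.symm = prodHomeo.symm ∘ fun p : ℂ × ℝ => (p.1 + z, p.2 + f p.1) := by
      ext1 p
      exact hT _
    rw [this, ← Measure.map_map hsm (shear z f hf).measurable, (shear z f hf).map_eq]
  have _ : ν.IsMulLeftInvariant := ⟨fun g => inv _ g.z (fun z => g.t + area g.z z / 2)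
    (by fun_prop) fun x => by ext <;> simp <;> ring⟩
  have _ : ν.IsMulRightInvariant := ⟨fun g => inv _ g.z (fun z => g.t + area z g.z / 2)
    (by fun_prop) fun x => by ext <;> simp ; ring⟩
  have hd := discreteTopology_stdLattice hn
  have _ : Countable (stdLattice n) := TopologicalSpace.separableSpace_iff_countable.1 inferInstance
  have _ : Countable (stdLattice n).op := 
    (stdLattice n).equivOp.symm.injective.countable
  have hF : IsFundamentalDomain (stdLattice n).op (stdDomain n) ν := by
    refine IsFundamentalDomain.mk' ?_ fun g => ?_
    · refine MeasurableSet.nullMeasurableSet ?_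
      have hc1 : Continuous fun g : Heisenberg => g.z.im := by fun_prop
      have hc2 : Continuous fun g : Heisenberg => g.z.re := by fun_prop
      have hc3 : Continuous fun g : Heisenberg => n * g.t := by fun_prop
      exact (hc1.measurable measurableSet_Ico).inter
        ((hc2.measurable measurableSet_Ico).inter (hc3.measurable measurableSet_Ico))
    · obtain ⟨γ, h1, h2⟩ := existsUnique_mul_mem_stdDomain hn g
      refine ⟨(stdLattice n).equivOp γ, h1, fun γ' h' => ?_⟩
      rw [← h2 ((stdLattice n).equivOp.symm γ') h']
      simp
  refine isLattice_of_isFundamentalDomain ν hd hF ?_ ?_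
  · have ho : IsOpen {g : Heisenberg | (0 < g.z.im ∧ g.z.im < 1) ∧ (0 < g.z.re ∧ g.z.re < 1) ∧
        (0 < n * g.t ∧ n * g.t < 1)} := by
      have hc1 : Continuous fun g : Heisenberg => g.z.im := by fun_prop
      have hc2 : Continuous fun g : Heisenberg => g.z.re := by fun_prop
      have hc3 : Continuous fun g : Heisenberg => n * g.t := by fun_prop
      exact (isOpen_Ioo.preimage hc1).inter
        ((isOpen_Ioo.preimage hc2).inter (isOpen_Ioo.preimage hc3))
    have hpos : 0 < ν {g : Heisenberg | (0 < g.z.im ∧ g.z.im < 1) ∧ (0 < g.z.re ∧ g.z.re < 1) ∧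
        (0 < n * g.t ∧ n * g.t < 1)} := by
      rw [Measure.map_apply hsm ho.measurableSet]
      refine (ho.preimage prodHomeo.symm.continuous).measure_pos _
        ⟨(⟨1 / 2, 1 / 2⟩, 1 / (2 * n)), ?_⟩
      have hn0 : (0 : ℝ) < n := by positivity
      have : (n : ℝ) * (1 / (2 * n)) = 1 / 2 := by field_simp
      refine ⟨⟨?_, ?_⟩, ⟨?_, ?_⟩, ?_⟩
      · change (0 : ℝ) < 1 / 2; norm_num
      · change (1 / 2 : ℝ) < 1; norm_num
      · change (0 : ℝ) < 1 / 2; norm_num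
      · change (1 / 2 : ℝ) < 1; norm_num
      · change 0 < (n : ℝ) * (1 / (2 * n)) ∧ (n : ℝ) * (1 / (2 * n)) < 1
        rw [this]; norm_num
    refine (hpos.trans_le (measure_mono ?_)).ne'
    rintro g ⟨⟨h1, h2⟩, ⟨h3, h4⟩, h5, h6⟩
    exact ⟨⟨h1.le, h2⟩, ⟨h3.le, h4⟩, h5.le, h6⟩
  · have hb : IsCompact (prodHomeo ⁻¹' (Metric.closedBall (0 : ℂ) 2 ×ˢ Set.Icc (0 : ℝ) 1)) :=
      prodHomeo.isCompact_preimage.2 ((isCompact_closedBall _ _).prod isCompact_Icc)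
    have hfin : ν (prodHomeo ⁻¹' (Metric.closedBall (0 : ℂ) 2 ×ˢ Set.Icc (0 : ℝ) 1)) < ⊤ := by
      rw [Measure.map_apply hsm hb.measurableSet]
      refine IsCompact.measure_lt_top ?_
      exact (isCompact_closedBall (0 : ℂ) 2).prod (isCompact_Icc (a := (0 : ℝ)) (b := 1))
    refine ((measure_mono ?_).trans_lt hfin).ne
    rintro g ⟨⟨h1, h2⟩, ⟨h3, h4⟩, h5, h6⟩
    have hn1 : (1 : ℝ) ≤ n := by exact_mod_cast hn
    refine ⟨?_, ?_, ?_⟩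
    · rw [mem_closedBall_zero_iff]
      refine (Complex.norm_le_abs_re_add_abs_im _).trans ?_
      change |g.z.re| + |g.z.im| ≤ 2
      rw [abs_of_nonneg h1, abs_of_nonneg h3]
      linarith
    · change 0 ≤ g.t
      by_contra! h
      nlinarith
    · change g.t ≤ 1
      by_contra! h
      nlinarith

theorem isLattice_latticeOf {n : ℕ} (hn : 1 ≤ n) (x : AutParam) :
    IsLattice (latticeOf n x).toSubgroup :=
  (isLattice_stdLattice hn).map x.toAut

end Heisenberg

end Lattice

/-! ### Classification of the lattices in the Heisenberg group -/

namespace Heisenberg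

open MeasureTheory

/-- The projection of a lattice to `ℂ` is not contained in the kernel of a nonzero linear form. -/
theorem exists_form_ne_zero {Γ : Subgroup Heisenberg} (hΓ : IsLattice Γ) (f : ℂ →L[ℝ] ℝ)
    (hf : f ≠ 0) : ∃ g ∈ Γ, f g.z ≠ 0 := by
  by_contra! hcon
  obtain ⟨-, μ, hμ1, hμ⟩ := hΓ
  let _ : MeasurableSpace (Heisenberg ⧸ Γ) := borel (Heisenberg ⧸ Γ)
  have _ : BorelSpace (Heisenberg ⧸ Γ) := ⟨rfl⟩
  obtain ⟨v, hv⟩ : ∃ v, f v = 1 := by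
    obtain ⟨v, hv⟩ : ∃ v, f v ≠ 0 := by
      by_contra! h
      exact hf (ContinuousLinearMap.ext h)
    exact ⟨(f v)⁻¹ • v, by rw [map_smul, smul_eq_mul, inv_mul_cancel₀ hv]⟩
  have hrel : ∀ a b : Heisenberg, QuotientGroup.leftRel Γ a b → f a.z = f b.z := by
    intro a b hab
    have h := hcon _ (QuotientGroup.leftRel_apply.1 hab)
    rw [mul_z, inv_z, map_add, map_neg] at h
    linarith
  let F : Heisenberg ⧸ Γ → ℝ := Quotient.lift (fun g => f g.z) hrel
  have hF : Continuous F := (f.continuous.comp continuous_z).quotient_lift hrel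
  let S : ℤ → Set (Heisenberg ⧸ Γ) := fun k => F ⁻¹' Set.Ico (k : ℝ) (k + 1)
  have hS : ∀ k, MeasurableSet (S k) := fun k => hF.measurable measurableSet_Ico
  have hμS : ∀ k, μ (S k) = μ (S 0) := by
    intro k
    rw [← hμ ⟨k • v, 0⟩ (S k) (hS k)]
    congr 1
    ext x
    induction x using QuotientGroup.induction_on with
    | H x =>
      change f (k • v + x.z) ∈ Set.Ico (k : ℝ) (k + 1) ↔ f x.z ∈ Set.Ico ((0 : ℤ) : ℝ) ((0 : ℤ) + 1)
      rw [map_add, map_zsmul, hv, Set.mem_Ico, Set.mem_Ico, zsmul_eq_mul]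
      push_cast
      constructor <;> rintro ⟨h1, h2⟩ <;> constructor <;> linarith
  have hunion : ⋃ k, S k = Set.univ := by
    refine Set.eq_univ_of_forall fun x => Set.mem_iUnion.2 ⟨⌊F x⌋, ?_, ?_⟩
    · exact Int.floor_le _
    · exact Int.lt_floor_add_one _
  have hdisj : Pairwise (Function.onFun Disjoint S) := by
    intro k l hkl
    refine Set.disjoint_left.2 fun x hk hl => hkl ?_
    rw [← Int.floor_eq_iff.2 hk, ← Int.floor_eq_iff.2 hl]
  have h1 := measure_iUnion (μ := μ) hdisj hS
  rw [hunion, hμ1, tsum_congr hμS] at h1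
  rcases eq_or_ne (μ (S 0)) 0 with h0 | h0
  · rw [h0, tsum_zero] at h1
    exact one_ne_zero h1
  · rw [ENNReal.tsum_const_eq_top_of_ne_zero h0] at h1
    exact ENNReal.one_ne_top h1

/-- The projection of a subgroup of the Heisenberg group to `ℂ`. -/
def proj (Γ : Subgroup Heisenberg) : AddSubgroup ℂ where
  carrier := z '' Γ
  zero_mem' := ⟨1, Γ.one_mem, rfl⟩
  add_mem' := by
    rintro _ _ ⟨g, hg, rfl⟩ ⟨h, hh, rfl⟩
    exact ⟨g * h, Γ.mul_mem hg hh, rfl⟩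
  neg_mem' := by
    rintro _ ⟨g, hg, rfl⟩
    exact ⟨g⁻¹, Γ.inv_mem hg, rfl⟩

/-- The projection of a lattice contains a frame. -/
theorem exists_frame {Γ : Subgroup Heisenberg} (hΓ : IsLattice Γ) :
    ∃ w : Frame, w.1.1 ∈ proj Γ ∧ w.1.2 ∈ proj Γ := by
  obtain ⟨g, hg, hg0⟩ := exists_form_ne_zero hΓ Complex.reCLM fun h => by
    simpa using congrArg (fun f => f 1) h
  obtain ⟨h, hh, hh0⟩ := exists_form_ne_zero hΓ
    (g.z.im • Complex.reCLM - g.z.re • Complex.imCLM) fun h => by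
      have := congrArg (fun f => f Complex.I) h
      simp at this
      exact hg0 this
  exact ⟨⟨(g.z, h.z), hh0⟩, ⟨g, hg, rfl⟩, ⟨h, hh, rfl⟩⟩

theorem discreteTopology_proj {Γ : Subgroup Heisenberg} (hΓ : IsClosed (Γ : Set Heisenberg))
    (hd : DiscreteTopology Γ) {w : Frame} (h1 : w.1.1 ∈ proj Γ) (h2 : w.1.2 ∈ proj Γ) :
    DiscreteTopology (proj Γ) := by
  open scoped commutatorElement in
  have hD : central (Multiplicative.ofAdd w.det) ∈ Γ := by
    obtain ⟨a, ha, ha'⟩ := h1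
    obtain ⟨b, hb, hb'⟩ := h2
    have : ⁅a, b⁆ ∈ Γ := Γ.mul_mem (Γ.mul_mem (Γ.mul_mem ha hb) (Γ.inv_mem ha)) (Γ.inv_mem hb)
    rwa [commutatorElement_eq, ha', hb'] at this
  set K : Set Heisenberg :=
    prodHomeo ⁻¹' (Metric.closedBall (0 : ℂ) 1 ×ˢ Metric.closedBall (0 : ℝ) |w.det|) with hK
  have hKc : IsCompact K :=
    prodHomeo.isCompact_preimage.2 ((isCompact_closedBall _ _).prod (isCompact_closedBall _ _))
  have hfin : ((Γ : Set Heisenberg) ∩ K).Finite := by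
    refine (hKc.inter_left hΓ).finite ?_
    have hd' : IsDiscrete (Γ : Set Heisenberg) := ⟨hd⟩
    exact hd'.mono Set.inter_subset_left
  have hsmall : ∀ u ∈ proj Γ, ‖u‖ ≤ 1 → u ∈ z '' ((Γ : Set Heisenberg) ∩ K) := by
    rintro _ ⟨g, hg, rfl⟩ hu
    refine ⟨g * central (Multiplicative.ofAdd w.det) ^ (-round (g.t / w.det)),
      ⟨Γ.mul_mem hg (Γ.zpow_mem hD _), ?_, ?_⟩, ?_⟩
    · rw [← map_zpow, mem_closedBall_zero_iff]
      change ‖g.z + 0‖ ≤ 1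
      rwa [add_zero]
    · rw [← map_zpow, mem_closedBall_zero_iff]
      change ‖(g * central _).t‖ ≤ _
      rw [mul_t, central_t, central_z, toAdd_zpow, toAdd_ofAdd, zsmul_eq_mul]
      have h3 := abs_sub_round (g.t / w.det)
      have h4 : g.t + ((-round (g.t / w.det) : ℤ) : ℝ) * w.det + area g.z 0 / 2 =
          (g.t / w.det - round (g.t / w.det)) * w.det := by
        have := w.det_ne_zero
        simp only [area, Complex.zero_re, Complex.zero_im]
        push_cast
        field_simp
        ring
      rw [h4, Real.norm_eq_abs, abs_mul]
      nlinarith [abs_nonneg w.det]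
    · rw [← map_zpow]
      change g.z + 0 = g.z
      rw [add_zero]
  refine discreteTopology_of_isOpen_singleton_zero ?_
  have ho : IsOpen (Metric.ball (0 : ℂ) 1 \ (z '' ((Γ : Set Heisenberg) ∩ K) \ {0})) :=
    Metric.isOpen_ball.sdiff ((hfin.image z).subset Set.sdiff_subset).isClosed
  convert ho.preimage (continuous_subtype_val (p := fun u => u ∈ proj Γ)) using 1
  ext ⟨u, hu⟩
  simp only [Set.mem_singleton_iff, Set.mem_preimage]
  constructor
  · intro h
    have : u = 0 := congrArg Subtype.val h
    subst this
    exact ⟨by simp, fun h => h.2 rfl⟩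
  · rintro ⟨h3, h4⟩
    rw [mem_ball_zero_iff] at h3
    by_contra h5
    exact h4 ⟨hsmall u hu h3.le, fun h => h5 (Subtype.ext h)⟩

theorem exists_liesOver {Γ : Subgroup Heisenberg} (hc : IsClosed (Γ : Set Heisenberg))
    (hΓ : IsLattice Γ) : ∃ w, LiesOver Γ w := by
  obtain ⟨w, h1, h2⟩ := exists_frame hΓ
  have hd := discreteTopology_proj hc hΓ.1 h1 h2
  let L : Submodule ℤ ℂ := (proj Γ).toIntSubmodule
  have _ : DiscreteTopology L := hd
  have _ : IsZLattice ℝ L := ⟨by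
    refine Submodule.eq_top_iff'.2 fun u => ?_
    rw [← w.lin_coords u]
    simp only [Frame.lin, ← Complex.real_smul]
    exact Submodule.add_mem _ (Submodule.smul_mem _ _ (Submodule.subset_span h1))
      (Submodule.smul_mem _ _ (Submodule.subset_span h2))⟩
  have hrank : Module.finrank ℤ L = 2 := by
    rw [ZLattice.rank ℝ L, Complex.finrank_real_complex]
  have _ := ZLattice.module_free ℝ L
  have _ := ZLattice.module_finite ℝ L
  let b := Module.finBasisOfFinrankEq ℤ L hrank
  have hspan := b.ofZLatticeBasis_span ℝ
  have hclosed : IsClosed (proj Γ : Set ℂ) := AddSubgroup.isClosed_of_discrete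
  obtain ⟨w', hw'⟩ := Frame.lattice_surjective
    ⟨⟨proj Γ, hclosed⟩, b.ofZLatticeBasis ℝ L, by
      have := congrArg Submodule.toAddSubgroup hspan
      rw [Submodule.span_int_eq_addSubgroupClosure] at this
      exact this.symm⟩
  refine ⟨w', fun u => ?_⟩
  rw [← w'.mem_lattice_iff, hw']
  rfl

/-- A lattice over a frame whose commutator subgroup has index `n` in its centre is the image of the
standard one under an automorphism. -/
theorem exists_eq_latticeOf {n : ℕ} (hn : 1 ≤ n) {Λ : ClosedSubgroup Heisenberg} {w : Frame}
    (hw : LiesOver Λ.toSubgroup w)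
    (hi : (commutator Λ.toSubgroup).relIndex (Subgroup.center Λ.toSubgroup) = n) :
    ∃ a, Λ = latticeOf n (w, a) := by
  obtain ⟨a, ha, haz⟩ := hw.exists_fst
  obtain ⟨b, hb, hbz⟩ := hw.exists_snd
  have hd := w.det_ne_zero
  refine ⟨(a.t / w.det - 1 / 2, b.t / w.det - 1 / 2), eq_latticeOf hn hw hi ?_ ?_⟩
  · convert ha
    refine Heisenberg.ext ?_ ?_
    · rw [haz]
      exact w.lin_I
    · simp [AutParam.act, liftI, AutParam.form]
      field_simp
  · convert hb
    refine Heisenberg.ext ?_ ?_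
    · rw [hbz]
      exact w.lin_one
    · simp [AutParam.act, liftOne, AutParam.form]
      field_simp

end Heisenberg

/-! ### The topology of the space of lattices -/

namespace Heisenberg

/-- The images of the standard lattice, as points of the space of lattices. -/
noncomputable def toLattice {n : ℕ} (hn : 1 ≤ n) (x : AutParam) : HeisenbergLattice n :=
  ⟨latticeOf n x, isLattice_latticeOf hn x, relIndex_latticeOf hn x⟩

theorem exists_toLattice_eq {n : ℕ} (hn : 1 ≤ n) (Λ : HeisenbergLattice n) {w : Frame}
    (hw : LiesOver Λ.1.toSubgroup w) : ∃ a, toLattice hn (w, a) = Λ := by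
  obtain ⟨a, ha⟩ := exists_eq_latticeOf hn hw Λ.2.2
  exact ⟨a, Subtype.ext ha.symm⟩

theorem toLattice_surjective {n : ℕ} (hn : 1 ≤ n) : Function.Surjective (toLattice hn) := by
  intro Λ
  obtain ⟨w, hw⟩ := exists_liesOver Λ.1.isClosed' Λ.2.1
  obtain ⟨a, ha⟩ := exists_toLattice_eq hn Λ hw
  exact ⟨_, ha⟩

theorem continuous_toLattice {n : ℕ} (hn : 1 ≤ n) : Continuous (toLattice hn) := by
  refine continuous_induced_rng.2 (continuous_induced_rng.2 ?_)
  exact continuous_chabauty_image (act := AutParam.act) (inv := AutParam.invAct)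
    (fun x => x.invAct_act) (fun x => x.act_invAct)
    (fun g => AutParam.continuous_act.comp (Continuous.prodMk_left g))
    AutParam.continuous_invAct ⟨stdLattice n, isClosed_stdLattice n⟩ (coe_latticeOf n)

/-- The images of the lifts of `I` and `1` under an automorphism can be prescribed. -/
theorem isOpenMap_act_lifts :
    IsOpenMap fun x : AutParam => (x.act liftI, x.act liftOne) := by
  let e : AutParam ≃ₜ Frame × ℝ × ℝ :=
    { toFun := fun x => (x.1, x.1.det * (1 / 2 + x.2.1), x.1.det * (1 / 2 + x.2.2))
      invFun := fun x => (x.1, x.2.1 / x.1.det - 1 / 2, x.2.2 / x.1.det - 1 / 2)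
      left_inv := fun x => by simp [x.1.det_ne_zero]
      right_inv := fun x => by
        have := x.1.det_ne_zero
        refine Prod.ext rfl (Prod.ext ?_ ?_) <;> simp <;> field_simp
      continuous_toFun := by fun_prop
      continuous_invFun := by
        refine continuous_fst.prodMk (Continuous.prodMk ?_ ?_)
        · exact (Continuous.div (by fun_prop) (by fun_prop) fun x => x.1.det_ne_zero).sub
            continuous_const
        · exact (Continuous.div (by fun_prop) (by fun_prop) fun x => x.1.det_ne_zero).sub
            continuous_const }
  have h1 : IsOpenMap fun x : Frame × ℝ × ℝ => ((x.1.1, x.2) : (ℂ × ℂ) × ℝ × ℝ) :=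
    (Frame.isOpen_frames.isOpenEmbedding_subtypeVal.prodMap .id).isOpenMap
  have h2 := ((Homeomorph.prodProdProdComm ℂ ℂ ℝ ℝ).trans
    (prodHomeo.symm.prodCongr prodHomeo.symm)).isOpenMap
  convert h2.comp (h1.comp e.isOpenMap) using 1
  ext1 x
  refine Prod.ext (Heisenberg.ext ?_ ?_) (Heisenberg.ext ?_ ?_)
  · exact x.1.lin_I
  · simp [AutParam.act, AutParam.form, liftI, e, prodHomeo]
    rfl
  · exact x.1.lin_one
  · simp [AutParam.act, AutParam.form, liftOne, e, prodHomeo]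
    rfl

/-- The elements of the Heisenberg group over the annulus with bounded central coordinate. -/
def annulus : Set Heisenberg := prodHomeo ⁻¹' (squareAnnulus ×ˢ Metric.closedBall (0 : ℝ) 1)

theorem isCompact_annulus : IsCompact annulus :=
  prodHomeo.isCompact_preimage.2 (isCompact_squareAnnulus.prod (isCompact_closedBall _ _))

/-- A subgroup of the Heisenberg group that contains the lifts of `I` and `1` and misses the annulus
projects to the Gaussian integers. -/
theorem mem_proj_iff_of_disjoint {Γ : Subgroup Heisenberg} (h1 : liftI ∈ Γ) (h2 : liftOne ∈ Γ)
    (hΓ : ∀ g ∈ annulus, g ∉ Γ) (z : ℂ) : z ∈ proj Γ ↔ z ∈ gaussianSet := by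
  have hI : Complex.I ∈ proj Γ := ⟨_, h1, rfl⟩
  have hone : (1 : ℂ) ∈ proj Γ := ⟨_, h2, rfl⟩
  constructor
  · refine mem_gaussianSet_of_disjoint hI hone ?_
    rintro _ hz ⟨g, hg, rfl⟩
    open scoped commutatorElement in
    have hc : central (Multiplicative.ofAdd 1) ∈ Γ := by
      have : ⁅liftI, liftOne⁆ ∈ Γ :=
        Γ.mul_mem (Γ.mul_mem (Γ.mul_mem h1 h2) (Γ.inv_mem h1)) (Γ.inv_mem h2)
      rw [commutatorElement_eq] at this
      simpa [liftI, liftOne, area] using this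
    refine hΓ (g * central (Multiplicative.ofAdd 1) ^ (-round g.t)) ⟨?_, ?_⟩
      (Γ.mul_mem hg (Γ.zpow_mem hc _))
    · rw [← map_zpow]
      change g.z + 0 ∈ squareAnnulus
      rwa [add_zero]
    · rw [← map_zpow, mem_closedBall_zero_iff]
      change ‖(g * central _).t‖ ≤ _
      have h3 := abs_sub_round g.t
      rw [mul_t, central_t, central_z, toAdd_zpow, toAdd_ofAdd, zsmul_eq_mul, Real.norm_eq_abs]
      simp only [area, Complex.zero_re, Complex.zero_im]
      push_cast
      have h4 : g.t + -(round g.t : ℝ) * 1 + (g.z.im * 0 - g.z.re * 0) / 2 = g.t - round g.t := by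
        ring
      rw [h4]
      linarith
  · rintro ⟨⟨k, hk⟩, l, hl⟩
    have h3 := (proj Γ).add_mem ((proj Γ).zsmul_mem hI k) ((proj Γ).zsmul_mem hone l)
    convert h3 using 1
    apply Complex.ext <;> simp [hk, hl]

theorem isOpenMap_toLattice {n : ℕ} (hn : 1 ≤ n) : IsOpenMap (toLattice hn) := by
  refine IsOpenMap.of_nhds_le fun x₀ S hS => ?_
  let toCl : HeisenbergLattice n → TopologicalSpace.Closeds Heisenberg :=
    fun Λ => ⟨(Λ.1 : Set Heisenberg), Λ.1.isClosed'⟩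
  let := chabautyTopology Heisenberg
  have htoCl : Continuous toCl := by
    have h : Continuous fun Λ : ClosedSubgroup Heisenberg =>
      (⟨(Λ : Set Heisenberg), Λ.isClosed'⟩ : TopologicalSpace.Closeds Heisenberg) :=
        continuous_induced_dom
    exact h.comp continuous_subtype_val
  have key := eventually_exists_param (C := toCl (toLattice hn x₀)) AutParam.continuous_act
    (isOpenMap_act_lifts.nhds_le x₀) (act_mem_latticeOf.2 (liftI_mem n))
    (act_mem_latticeOf.2 (liftOne_mem n)) isCompact_annulus
    (fun g hg hg' => disjoint_gaussianSet_squareAnnulus hg.1 (act_mem_latticeOf.1 hg').1) hS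
  filter_upwards [htoCl.tendsto _ key]
  rintro Λ ⟨x, hxS, h1, h2, hΛ⟩
  have hproj := mem_proj_iff_of_disjoint
    (Γ := Λ.1.toSubgroup.comap x.toAut.toMulEquiv.toMonoidHom) h1 h2 hΛ
  have hw : LiesOver Λ.1.toSubgroup x.1 := by
    intro z
    rw [← hproj]
    constructor
    · rintro ⟨g, hg, rfl⟩
      refine ⟨x.invAct g, ?_, rfl⟩
      change x.act (x.invAct g) ∈ Λ.1.toSubgroup
      rwa [AutParam.act_invAct]
    · rintro ⟨g, hg, hgz⟩
      refine ⟨x.act g, hg, ?_⟩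
      change x.1.lin g.z = z
      rw [hgz, Frame.lin_coords]
  have : Λ = toLattice hn x := Subtype.ext (eq_latticeOf hn hw Λ.2.2 h1 h2)
  rw [this]
  exact hxS

/-! ### The space of lattices as a homogeneous space -/

theorem discreteTopology_stabilizer {n : ℕ} (Λ : HeisenbergLattice n) (hn : 1 ≤ n) :
    DiscreteTopology (MulAction.stabilizer (Heisenberg ≃ₜ* Heisenberg) Λ.1) := by
  obtain ⟨x, rfl⟩ := toLattice_surjective hn Λ
  change DiscreteTopology (MulAction.stabilizer (Heisenberg ≃ₜ* Heisenberg) (latticeOf n x))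
  have hd : DiscreteTopology (latticeOf n x).toSubgroup := (isLattice_latticeOf hn x).1
  have hisol : ∀ p ∈ (latticeOf n x).toSubgroup, ∃ U : Set Heisenberg, IsOpen U ∧ p ∈ U ∧
      ∀ q ∈ U, q ∈ (latticeOf n x).toSubgroup → q = p := by
    intro p hp
    obtain ⟨U, hU, hUp⟩ := isOpen_induced_iff.1
      (isOpen_discrete ({⟨p, hp⟩} : Set (latticeOf n x).toSubgroup))
    refine ⟨U, hU, ?_, fun q hq hq' => ?_⟩
    · have : (⟨p, hp⟩ : (latticeOf n x).toSubgroup) ∈ Subtype.val ⁻¹' U := by rw [hUp]; rfl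
      exact this
    · have : (⟨q, hq'⟩ : (latticeOf n x).toSubgroup) ∈ Subtype.val ⁻¹' U := hq
      rw [hUp] at this
      exact congrArg Subtype.val this
  have h1 := act_mem_latticeOf (x := x).2 (liftI_mem n)
  have h2 := act_mem_latticeOf (x := x).2 (liftOne_mem n)
  obtain ⟨U₁, hU₁, hm₁, hs₁⟩ := hisol _ h1
  obtain ⟨U₂, hU₂, hm₂, hs₂⟩ := hisol _ h2
  have ho : IsOpen {φ : Heisenberg ≃ₜ* Heisenberg |
      φ (x.act liftI) ∈ U₁ ∧ φ (x.act liftOne) ∈ U₂} :=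
    (hU₁.preimage (continuous_eval_aut _)).inter (hU₂.preimage (continuous_eval_aut _))
  refine discreteTopology_of_isOpen_singleton_one ?_
  convert ho.preimage (continuous_subtype_val
    (p := fun φ => φ ∈ MulAction.stabilizer (Heisenberg ≃ₜ* Heisenberg) (latticeOf n x))) using 1
  ext ⟨φ, hφ⟩
  simp only [Set.mem_singleton_iff, Set.mem_preimage]
  constructor
  · intro h
    have : φ = 1 := congrArg Subtype.val h
    subst this
    exact ⟨hm₁, hm₂⟩
  · rintro ⟨h3, h4⟩
    have hmap : ∀ g ∈ (latticeOf n x).toSubgroup, φ g ∈ (latticeOf n x).toSubgroup := by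
      intro g hg
      have h5 : φ g ∈ (φ • latticeOf n x).toSubgroup := ⟨g, hg, rfl⟩
      rwa [MulAction.mem_stabilizer_iff.1 hφ] at h5
    have e1 := hs₁ _ h3 (hmap _ h1)
    have e2 := hs₂ _ h4 (hmap _ h2)
    obtain ⟨y, hy⟩ := exists_toAut_eq (x.toAut⁻¹ * φ * x.toAut)
    have hyg : ∀ g, y.act g = x.invAct (φ (x.act g)) := fun g => DFunLike.congr_fun hy g
    have f1 : y.act liftI = liftI := by rw [hyg, e1, x.invAct_act]
    have f2 : y.act liftOne = liftOne := by rw [hyg, e2, x.invAct_act]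
    have g1 : y.1.1.1 = Complex.I := y.1.lin_I.symm.trans (congrArg z f1)
    have g2 : y.1.1.2 = 1 := y.1.lin_one.symm.trans (congrArg z f2)
    have g3 : y.1.det = 1 := by simp [Frame.det, g1, g2, area]
    have g4 := congrArg t f1
    have g5 := congrArg t f2
    simp [AutParam.act, AutParam.form, g3, liftI, liftOne] at g4 g5
    have hid : ∀ g, y.act g = g := by
      intro g
      refine Heisenberg.ext ?_ ?_
      · apply Complex.ext <;> simp [AutParam.act, Frame.lin, g1, g2]
      · simp [AutParam.act, AutParam.form, g3, g4, g5]
    apply Subtype.ext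
    refine ContinuousMulEquiv.ext fun g => ?_
    have h6 := hyg (x.invAct g)
    rw [hid, x.act_invAct] at h6
    have h7 := congrArg x.act h6
    rw [x.act_invAct, x.act_invAct] at h7
    exact h7.symm

theorem exists_homeomorph_quotient {n : ℕ} (hn : 1 ≤ n) (Λ₀ : HeisenbergLattice n) :
    ∃ e : ((Heisenberg ≃ₜ* Heisenberg) ⧸
      MulAction.stabilizer (Heisenberg ≃ₜ* Heisenberg) Λ₀.1) ≃ₜ HeisenbergLattice n,
      ∀ φ : Heisenberg ≃ₜ* Heisenberg, (e (QuotientGroup.mk φ)).1 = φ • Λ₀.1 := by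
  obtain ⟨x, rfl⟩ := toLattice_surjective hn Λ₀
  let o : (Heisenberg ≃ₜ* Heisenberg) → HeisenbergLattice n :=
    fun φ => toLattice hn (autHomeo.symm (φ * x.toAut))
  have ho : ∀ φ, (o φ).1 = φ • (toLattice hn x).1 := by
    intro φ
    change (autHomeo (autHomeo.symm (φ * x.toAut))) • stdClosed n = φ • x.toAut • stdClosed n
    rw [autHomeo.apply_symm_apply, mul_smul]
  have hoc : Continuous o := (continuous_toLattice hn).comp
    (autHomeo.symm.continuous.comp (continuous_mul_const x.toAut))
  have hoo : IsOpenMap o := (isOpenMap_toLattice hn).comp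
    (autHomeo.symm.isOpenMap.comp (isOpenMap_mul_right x.toAut))
  have hos : Function.Surjective o := (toLattice_surjective hn).comp
    (autHomeo.symm.surjective.comp (Group.mulRight_bijective x.toAut).surjective)
  have hrel : ∀ φ ψ : Heisenberg ≃ₜ* Heisenberg,
      QuotientGroup.leftRel (MulAction.stabilizer _ (toLattice hn x).1) φ ψ ↔ o φ = o ψ := by
    intro φ ψ
    rw [QuotientGroup.leftRel_apply, MulAction.mem_stabilizer_iff, Subtype.ext_iff, ho, ho,
      mul_smul, inv_smul_eq_iff, eq_comm]
  let F := Quotient.lift o fun φ ψ h => (hrel φ ψ).1 h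
  have hF : Function.Bijective F := by
    constructor
    · intro a b
      induction a using Quotient.inductionOn with
      | h φ =>
        induction b using Quotient.inductionOn with
        | h ψ => exact fun h => Quotient.sound ((hrel φ ψ).2 h)
    · intro Λ
      obtain ⟨φ, rfl⟩ := hos Λ
      exact ⟨Quotient.mk _ φ, rfl⟩
  have hFo : IsOpenMap F := by
    intro U hU
    have : F '' U = o '' (Quotient.mk _ ⁻¹' U) := by
      ext Λ
      constructor
      · rintro ⟨a, ha, rfl⟩
        induction a using Quotient.inductionOn with
        | h φ => exact ⟨φ, ha, rfl⟩
      · rintro ⟨φ, hφ, rfl⟩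
        exact ⟨_, hφ, rfl⟩
    rw [this]
    exact hoo _ (hU.preimage continuous_quotient_mk')
  exact ⟨(Equiv.ofBijective F hF).toHomeomorphOfContinuousOpen (hoc.quotient_lift _) hFo, ho⟩

end Heisenberg

/-! ### The torus bundles -/

namespace Heisenberg

/-- Rescaling of the linear form of a parameter. -/
noncomputable def rescale {n : ℕ} (hn : 1 ≤ n) : AutParam ≃ₜ AutParam where
  toFun x := (x.1, x.2.1 / n, x.2.2 / n)
  invFun x := (x.1, n * x.2.1, n * x.2.2)
  left_inv x := by
    have : (n : ℝ) ≠ 0 := by positivity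
    refine Prod.ext rfl (Prod.ext ?_ ?_) <;> simp <;> field_simp
  right_inv x := by
    have : (n : ℝ) ≠ 0 := by positivity
    refine Prod.ext rfl (Prod.ext ?_ ?_) <;> simp <;> field_simp
  continuous_toFun := by fun_prop
  continuous_invFun := by fun_prop

/-- The lattice with a given frame and given angular coordinates. -/
noncomputable def angleLattice {n : ℕ} (hn : 1 ≤ n) (x : AutParam) : HeisenbergLattice n :=
  toLattice hn (rescale hn x)

section

variable {n : ℕ} (hn : 1 ≤ n)

theorem continuous_angleLattice : Continuous (angleLattice hn) :=
  (continuous_toLattice hn).comp (rescale hn).continuous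

theorem isOpenMap_angleLattice : IsOpenMap (angleLattice hn) :=
  (isOpenMap_toLattice hn).comp (rescale hn).isOpenMap

theorem angleLattice_surjective : Function.Surjective (angleLattice hn) :=
  (toLattice_surjective hn).comp (rescale hn).surjective

theorem liesOver_angleLattice (x : AutParam) :
    LiesOver (angleLattice hn x).1.toSubgroup x.1 := liesOver_latticeOf n (rescale hn x)

theorem mem_angleLattice {x : AutParam} {g : Heisenberg} :
    g ∈ (angleLattice hn x).1.toSubgroup ↔ ∃ k l m : ℤ, g.z = k * x.1.1.1 + l * x.1.1.2 ∧
      n * g.t = x.1.det * (m + k * x.2.1 + l * x.2.2 + n * (k * l + k + l) / 2) := by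
  have hn0 : (n : ℝ) ≠ 0 := by positivity
  have hd := x.1.det_ne_zero
  refine mem_latticeOf.trans ?_
  have hform : ∀ k l : ℤ, (rescale hn x).form ⟨l, k⟩ = x.2.1 / n * k + x.2.2 / n * l :=
    fun _ _ => rfl
  constructor
  · rintro ⟨⟨⟨k, hk⟩, l, hl⟩, m, hm⟩
    have hz : x.1.coords g.z = ⟨l, k⟩ := Complex.ext hl hk
    refine ⟨k, l, m, ?_, ?_⟩
    · rw [← x.1.lin_coords g.z, hz]
      simp [Frame.lin]
    · change n * (g.t / x.1.det - (rescale hn x).form (x.1.coords g.z) -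
        ((x.1.coords g.z).im * (x.1.coords g.z).re + (x.1.coords g.z).im +
          (x.1.coords g.z).re) / 2) = m at hm
      rw [hz, hform] at hm
      rw [← hm]
      field_simp
      ring
  · rintro ⟨k, l, m, hz, ht⟩
    have hz' : x.1.coords g.z = ⟨l, k⟩ := by
      rw [← x.1.coords_lin ⟨l, k⟩, hz]
      simp [Frame.lin]
    refine ⟨?_, m, ?_⟩
    · change x.1.coords g.z ∈ gaussianSet
      rw [hz']
      exact ⟨⟨k, rfl⟩, l, rfl⟩
    · change n * (g.t / x.1.det - (rescale hn x).form (x.1.coords g.z) -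
        ((x.1.coords g.z).im * (x.1.coords g.z).re + (x.1.coords g.z).im +
          (x.1.coords g.z).re) / 2) = m
      rw [hz', hform]
      have ht' : g.t = x.1.det * (m + k * x.2.1 + l * x.2.2 + n * (k * l + k + l) / 2) / n := by
        rw [← ht]; field_simp
      rw [ht']
      field_simp
      ring

end

/-- The parameters `x` and `y` differ by an integral change of frame. -/
def IntEquiv (x y : AutParam) : Prop :=
  ∃ a b c d i j e : ℤ, a * d - b * c = e ∧ e * e = 1 ∧
    y.1.1.1 = a * x.1.1.1 + b * x.1.1.2 ∧ y.1.1.2 = c * x.1.1.1 + d * x.1.1.2 ∧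
    e * y.2.1 = a * x.2.1 + b * x.2.2 + i ∧ e * y.2.2 = c * x.2.1 + d * x.2.2 + j

theorem IntEquiv.symm {x y : AutParam} (h : IntEquiv x y) : IntEquiv y x := by
  obtain ⟨a, b, c, d, i, j, e, he, hee, h1, h2, h3, h4⟩ := h
  have heC : ((a : ℂ) * d - b * c) * e = 1 := by exact_mod_cast (by rw [he]; exact hee)
  have heR : ((a : ℝ) * d - b * c) = e := by exact_mod_cast he
  have heeR : (e : ℝ) * e = 1 := by exact_mod_cast hee
  refine ⟨e * d, -(e * b), -(e * c), e * a, b * j - d * i, c * i - a * j, e, ?_, hee,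
    ?_, ?_, ?_, ?_⟩
  · linear_combination (e * e) * he + e * hee
  · rw [h1, h2]
    push_cast
    linear_combination (-x.1.1.1) * heC
  · rw [h1, h2]
    push_cast
    linear_combination (-x.1.1.2) * heC
  · push_cast
    linear_combination (-x.2.1) * heR - d * h3 + b * h4
  · push_cast
    linear_combination (-x.2.2) * heR + c * h3 - a * h4

theorem IntEquiv.det_eq {x y : AutParam} {a b c d : ℤ}
    (h1 : y.1.1.1 = a * x.1.1.1 + b * x.1.1.2) (h2 : y.1.1.2 = c * x.1.1.1 + d * x.1.1.2) :
    y.1.det = ((a * d - b * c : ℤ) : ℝ) * x.1.det := by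
  unfold Frame.det
  rw [h1, h2]
  simp [area_def]
  ring

theorem IntEquiv.le {n : ℕ} (hn : 1 ≤ n) {x y : AutParam} (h : IntEquiv x y) :
    (angleLattice hn y).1.toSubgroup ≤ (angleLattice hn x).1.toSubgroup := by
  obtain ⟨a, b, c, d, i, j, e, he, hee, h1, h2, h3, h4⟩ := h
  intro g hg
  obtain ⟨k, l, m, hz, ht⟩ := (mem_angleLattice hn).1 hg
  have hdet := IntEquiv.det_eq h1 h2
  rw [he] at hdet
  obtain ⟨r, hr⟩ : (2 : ℤ) ∣ e * (k * l + k + l) -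
      ((k * a + l * c) * (k * b + l * d) + (k * a + l * c) + (k * b + l * d)) := by
    have key : ∀ a b c d k l : ZMod 2, (a * d - b * c) * (a * d - b * c) = 1 →
        (a * d - b * c) * (k * l + k + l) -
        ((k * a + l * c) * (k * b + l * d) + (k * a + l * c) + (k * b + l * d)) = 0 := by decide
    have h5 := (ZMod.intCast_zmod_eq_zero_iff_dvd (e * (k * l + k + l) -
      ((k * a + l * c) * (k * b + l * d) + (k * a + l * c) + (k * b + l * d))) 2).1 (by
        rw [← he]
        push_cast
        refine key _ _ _ _ _ _ ?_
        rw [← he] at hee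
        exact_mod_cast congrArg (Int.cast : ℤ → ZMod 2) hee)
    exact_mod_cast h5
  have hr' : (e : ℝ) * (k * l + k + l) -
      ((k * a + l * c) * (k * b + l * d) + (k * a + l * c) + (k * b + l * d)) = 2 * r := by
    exact_mod_cast hr
  refine (mem_angleLattice hn).2 ⟨k * a + l * c, k * b + l * d, e * m + k * i + l * j + n * r,
    ?_, ?_⟩
  · rw [hz, h1, h2]
    push_cast
    ring
  · rw [ht, hdet]
    push_cast
    linear_combination (x.1.det * k) * h3 + (x.1.det * l) * h4 + (x.1.det * n / 2) * hr'

theorem IntEquiv.of_eq {n : ℕ} (hn : 1 ≤ n) {x y : AutParam}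
    (h : angleLattice hn x = angleLattice hn y) : IntEquiv x y := by
  have hn0 : (n : ℝ) ≠ 0 := by positivity
  have hd := x.1.det_ne_zero
  have key : ∀ {x y : AutParam}, angleLattice hn x = angleLattice hn y → ∃ a b c d i j : ℤ,
      y.1.1.1 = a * x.1.1.1 + b * x.1.1.2 ∧ y.1.1.2 = c * x.1.1.1 + d * x.1.1.2 ∧
      y.1.det * (y.2.1 + n / 2) = x.1.det * (i + a * x.2.1 + b * x.2.2 + n * (a * b + a + b) / 2) ∧
      y.1.det * (y.2.2 + n / 2) =
        x.1.det * (j + c * x.2.1 + d * x.2.2 + n * (c * d + c + d) / 2) := by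
    intro x y h
    have h1 : (⟨y.1.1.1, y.1.det * (y.2.1 + n / 2) / n⟩ : Heisenberg) ∈
        (angleLattice hn x).1.toSubgroup := by
      rw [h]
      refine (mem_angleLattice hn).2 ⟨1, 0, 0, by simp, ?_⟩
      field_simp
      push_cast
      ring
    have h2 : (⟨y.1.1.2, y.1.det * (y.2.2 + n / 2) / n⟩ : Heisenberg) ∈
        (angleLattice hn x).1.toSubgroup := by
      rw [h]
      refine (mem_angleLattice hn).2 ⟨0, 1, 0, by simp, ?_⟩
      field_simp
      push_cast
      ring
    obtain ⟨a, b, i, h3, h4⟩ := (mem_angleLattice hn).1 h1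
    obtain ⟨c, d, j, h5, h6⟩ := (mem_angleLattice hn).1 h2
    refine ⟨a, b, c, d, i, j, h3, h5, ?_, ?_⟩
    · rw [← h4]; field_simp
    · rw [← h6]; field_simp
  obtain ⟨a, b, c, d, i, j, h1, h2, h3, h4⟩ := key h
  obtain ⟨a', b', c', d', -, -, h1', h2', -, -⟩ := key h.symm
  have hdet := IntEquiv.det_eq h1 h2
  have hdet' := IntEquiv.det_eq h1' h2'
  set e := a * d - b * c with he
  have hmul : (a' * d' - b' * c') * e = 1 := by
    have : ((a' * d' - b' * c' : ℤ) : ℝ) * e = 1 := by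
      apply mul_right_cancel₀ hd
      rw [mul_assoc, ← hdet, ← hdet', one_mul]
    exact_mod_cast this
  have hee : e * e = 1 := by
    rcases Int.eq_one_or_neg_one_of_mul_eq_one' hmul with ⟨-, h⟩ | ⟨-, h⟩ <;> rw [h] <;> rfl
  have parity : ∀ u v : ℤ, (∃ p q : ℤ, u * q - v * p = e ∨ p * v - q * u = e) →
      ∃ r : ℤ, u * v + u + v - e = 2 * r := by
    rintro u v ⟨p, q, hpq⟩
    have key1 : ∀ u v p q : ZMod 2, u * q - v * p = 1 → u * v + u + v = 1 := by decide
    have he1 : (e : ZMod 2) = 1 := by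
      have : ∀ e : ZMod 2, e * e = 1 → e = 1 := by decide
      exact this _ (by exact_mod_cast congrArg (Int.cast : ℤ → ZMod 2) hee)
    have h5 := (ZMod.intCast_zmod_eq_zero_iff_dvd (u * v + u + v - e) 2).1 (by
      push_cast
      rw [he1, sub_eq_zero]
      rcases hpq with hpq | hpq
      · refine key1 _ _ p q ?_
        rw [← he1]
        exact_mod_cast congrArg (Int.cast : ℤ → ZMod 2) hpq
      · refine key1 _ _ (-p) (-q) ?_
        rw [← he1, ← hpq]
        push_cast
        ring)
    exact_mod_cast h5
  obtain ⟨r, hr⟩ := parity a b ⟨c, d, Or.inl rfl⟩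
  obtain ⟨s, hs⟩ := parity c d ⟨a, b, Or.inr (by rw [he])⟩
  have hr' : (a : ℝ) * b + a + b - e = 2 * r := by exact_mod_cast hr
  have hs' : (c : ℝ) * d + c + d - e = 2 * s := by exact_mod_cast hs
  rw [hdet, mul_comm (e : ℝ), mul_assoc, mul_right_inj' hd] at h3 h4
  refine ⟨a, b, c, d, i + n * r, j + n * s, e, rfl, hee, h1, h2, ?_, ?_⟩
  · push_cast
    linear_combination h3 + (n / 2 : ℝ) * hr'
  · push_cast
    linear_combination h4 + (n / 2 : ℝ) * hs'

theorem angleLattice_eq_iff {n : ℕ} (hn : 1 ≤ n) {x y : AutParam} :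
    angleLattice hn x = angleLattice hn y ↔ IntEquiv x y := by
  refine ⟨IntEquiv.of_eq hn, fun h => ?_⟩
  apply Subtype.ext
  apply SetLike.coe_injective
  exact Set.Subset.antisymm (h.symm.le hn) (h.le hn)

/-- The projection of lattices in the Heisenberg group to lattices in `ℂ`. -/
noncomputable def projLattice {n : ℕ} (hn : 1 ≤ n) (Λ : HeisenbergLattice n) : ComplexLattice :=
  (Function.surjInv (toLattice_surjective hn) Λ).1.lattice

theorem coe_projLattice {n : ℕ} (hn : 1 ≤ n) (Λ : HeisenbergLattice n) :
    ((projLattice hn Λ).1 : Set ℂ) = z '' (Λ.1 : Set Heisenberg) := by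
  have h := liesOver_latticeOf n (Function.surjInv (toLattice_surjective hn) Λ)
  have hΛ : latticeOf n (Function.surjInv (toLattice_surjective hn) Λ) = Λ.1 :=
    congrArg Subtype.val (Function.surjInv_eq (toLattice_surjective hn) Λ)
  rw [hΛ] at h
  ext u
  exact (Frame.mem_lattice_iff _ u).trans (h u).symm

theorem projLattice_eq_iff {n : ℕ} (hn : 1 ≤ n) {Λ : HeisenbergLattice n} {w : Frame} :
    projLattice hn Λ = w.lattice ↔ LiesOver Λ.1.toSubgroup w := by
  rw [Subtype.ext_iff, ← SetLike.coe_set_eq, coe_projLattice, Set.ext_iff]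
  exact forall_congr' fun u => by
    rw [← w.mem_lattice_iff]
    rfl

theorem projLattice_angleLattice {n : ℕ} (hn : 1 ≤ n) (x : AutParam) :
    projLattice hn (angleLattice hn x) = x.1.lattice :=
  (projLattice_eq_iff hn).2 (liesOver_angleLattice hn x)

theorem isQuotientMap_angleLattice {n : ℕ} (hn : 1 ≤ n) : IsQuotientMap (angleLattice hn) :=
  (isOpenMap_angleLattice hn).isQuotientMap (continuous_angleLattice hn)
    (angleLattice_surjective hn)

/-- The covering of the torus by the plane. -/
noncomputable def torusMk (θ : ℝ × ℝ) : Torus := (θ.1, θ.2)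

theorem isOpenQuotientMap_torusMk : IsOpenQuotientMap torusMk :=
  (QuotientAddGroup.isOpenQuotientMap_mk (N := AddSubgroup.zmultiples (1 : ℝ))).prodMap
    QuotientAddGroup.isOpenQuotientMap_mk

theorem torusMk_eq_iff {θ θ' : ℝ × ℝ} : torusMk θ = torusMk θ' ↔
    (∃ i : ℤ, θ'.1 = θ.1 + i) ∧ ∃ j : ℤ, θ'.2 = θ.2 + j := by
  have h : ∀ s t : ℝ, (s : UnitAddCircle) = t ↔ ∃ i : ℤ, t = s + i := fun s t => by
    rw [QuotientAddGroup.eq, AddSubgroup.mem_zmultiples_iff]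
    refine exists_congr fun i => ?_
    rw [zsmul_one, eq_neg_add_iff_add_eq, eq_comm]
  exact Prod.ext_iff.trans (and_congr (h _ _) (h _ _))

section

variable {n : ℕ} (hn : 1 ≤ n)

theorem angleLattice_eq_iff_torusMk (w : Frame) {θ θ' : ℝ × ℝ} :
    angleLattice hn (w, θ) = angleLattice hn (w, θ') ↔ torusMk θ = torusMk θ' := by
  rw [angleLattice_eq_iff, torusMk_eq_iff]
  constructor
  · rintro ⟨a, b, c, d, i, j, e, he, -, h1, h2, h3, h4⟩
    have e1 : ∀ a b : ℤ, (a : ℂ) * w.1.1 + b * w.1.2 = w.lin ⟨b, a⟩ := fun a b => by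
      simp [Frame.lin]
    simp only [e1] at h1 h2
    have h1' := w.lin_injective (w.lin_I.trans h1)
    have h2' := w.lin_injective (w.lin_one.trans h2)
    have haR : (a : ℝ) = 1 := (congrArg Complex.im h1').symm
    have ha : a = 1 := by exact_mod_cast haR
    have hbR : (b : ℝ) = 0 := (congrArg Complex.re h1').symm
    have hb : b = 0 := by exact_mod_cast hbR
    have hcR : (c : ℝ) = 0 := (congrArg Complex.im h2').symm
    have hc : c = 0 := by exact_mod_cast hcR
    have hdR : (d : ℝ) = 1 := (congrArg Complex.re h2').symm
    have hd : d = 1 := by exact_mod_cast hdR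
    subst ha hb hc hd
    norm_num at he
    subst he
    exact ⟨⟨i, by simpa using h3⟩, j, by simpa using h4⟩
  · rintro ⟨⟨i, hi⟩, j, hj⟩
    exact ⟨1, 0, 0, 1, i, j, 1, by norm_num, by norm_num, by simp, by simp, by simpa using hi,
      by simpa using hj⟩

/-- The lattice with a given frame and given angles. -/
noncomputable def torusLattice (p : Frame × Torus) : HeisenbergLattice n :=
  angleLattice hn (p.1, Function.surjInv isOpenQuotientMap_torusMk.surjective p.2)

theorem torusLattice_mk (w : Frame) (θ : ℝ × ℝ) :
    torusLattice hn (w, torusMk θ) = angleLattice hn (w, θ) :=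
  (angleLattice_eq_iff_torusMk hn w).2 (Function.surjInv_eq _ _)

theorem isOpenQuotientMap_id_torusMk : IsOpenQuotientMap (Prod.map (id : Frame → Frame) torusMk) :=
  IsOpenQuotientMap.id.prodMap isOpenQuotientMap_torusMk

theorem torusLattice_comp :
    torusLattice hn ∘ Prod.map (id : Frame → Frame) torusMk = angleLattice hn :=
  funext fun x => torusLattice_mk hn x.1 x.2

theorem continuous_torusLattice : Continuous (torusLattice hn) := by
  rw [isOpenQuotientMap_id_torusMk.isQuotientMap.continuous_iff, torusLattice_comp]
  exact continuous_angleLattice hn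

theorem isOpenMap_torusLattice : IsOpenMap (torusLattice hn) := by
  refine IsOpenMap.of_comp isOpenQuotientMap_id_torusMk.continuous
    isOpenQuotientMap_id_torusMk.surjective ?_
  rw [torusLattice_comp]
  exact isOpenMap_angleLattice hn

theorem projLattice_torusLattice (p : Frame × Torus) :
    projLattice hn (torusLattice hn p) = p.1.lattice :=
  projLattice_angleLattice hn _

theorem torusLattice_injective_right {w : Frame} {c c' : Torus}
    (h : torusLattice hn (w, c) = torusLattice hn (w, c')) : c = c' := by
  obtain ⟨θ, rfl⟩ := isOpenQuotientMap_torusMk.surjective c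
  obtain ⟨θ', rfl⟩ := isOpenQuotientMap_torusMk.surjective c'
  rw [torusLattice_mk, torusLattice_mk] at h
  exact (angleLattice_eq_iff_torusMk hn w).1 h

theorem exists_torusLattice_eq {Λ : HeisenbergLattice n} {w : Frame}
    (h : projLattice hn Λ = w.lattice) : ∃ c, torusLattice hn (w, c) = Λ := by
  obtain ⟨a, ha⟩ := exists_toLattice_eq hn Λ ((projLattice_eq_iff hn).1 h)
  refine ⟨torusMk ((rescale hn).symm (w, a)).2, ?_⟩
  rw [torusLattice_mk, ← ha]
  exact congrArg (toLattice hn) ((rescale hn).apply_symm_apply (w, a))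

theorem isTorusBundle_projLattice : IsTorusBundle (projLattice hn) := by
  intro L
  obtain ⟨w₀, rfl⟩ := Frame.lattice_surjective L
  obtain ⟨V', hV', hinj'⟩ := w₀.exists_injOn_lattice
  obtain ⟨V, hVV', hV, hw₀⟩ := mem_nhds_iff.1 hV'
  have hinj := hinj'.mono hVV'
  have hbase : IsOpenEmbedding fun w : V => (w : Frame).lattice :=
    .of_continuous_injective_isOpenMap (Frame.continuous_lattice.comp continuous_subtype_val)
      (fun v v' h => Subtype.ext (hinj v.2 v'.2 h))
      (Frame.isOpenMap_lattice.comp hV.isOpenMap_subtype_val)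
  have h1 : IsOpenEmbedding fun p : V × Torus => torusLattice hn ((p.1 : Frame), p.2) := by
    refine .of_continuous_injective_isOpenMap ?_ ?_ ?_
    · exact (continuous_torusLattice hn).comp (by fun_prop)
    · rintro ⟨v, c⟩ ⟨v', c'⟩ h
      have hv : v = v' := hbase.injective (by
        have := congrArg (projLattice hn) h
        rwa [projLattice_torusLattice, projLattice_torusLattice] at this)
      subst hv
      exact congrArg (Prod.mk v) (torusLattice_injective_right hn h)
    · exact (isOpenMap_torusLattice hn).comp (hV.isOpenMap_subtype_val.prodMap IsOpenMap.id)
  have h2 : IsOpenEmbedding (Prod.map (fun w : V => (w : Frame).lattice) (id : Torus → Torus)) :=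
    hbase.prodMap .id
  have _ : Nonempty (V × Torus) := ⟨⟨w₀, hw₀⟩, 0⟩
  let e₁ := h1.toOpenPartialHomeomorph
  let e₂ := h2.toOpenPartialHomeomorph
  refine ⟨{
    toOpenPartialHomeomorph := e₁.symm.trans e₂
    baseSet := Set.range fun w : V => (w : Frame).lattice
    open_baseSet := hbase.isOpen_range
    source_eq := ?_
    target_eq := ?_
    proj_toFun := ?_ }, ⟨⟨w₀, hw₀⟩, rfl⟩⟩
  · have : (e₁.symm.trans e₂).source =
        Set.range fun p : V × Torus => torusLattice hn ((p.1 : Frame), p.2) := by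
      simp [e₁, e₂]
    rw [this]
    ext Λ
    constructor
    · rintro ⟨p, rfl⟩
      rw [Set.mem_preimage, projLattice_torusLattice]
      exact Set.mem_range_self p.1
    · intro hΛ
      obtain ⟨w, hw⟩ := Set.mem_range.1 (Set.mem_preimage.1 hΛ)
      obtain ⟨c, hc⟩ := exists_torusLattice_eq hn hw.symm
      exact ⟨(w, c), hc⟩
  · have : (e₁.symm.trans e₂).target = Set.range
        (Prod.map (fun w : V => (w : Frame).lattice) (id : Torus → Torus)) := by
      simp [e₁, e₂]
    rw [this, Set.range_prodMap, Set.range_id]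
  · intro Λ hΛ
    obtain ⟨p, rfl⟩ : Λ ∈ Set.range
        fun p : V × Torus => torusLattice hn ((p.1 : Frame), p.2) := by
      simpa [e₁, e₂] using hΛ
    have : e₁.symm (torusLattice hn ((p.1 : Frame), p.2)) = p :=
      h1.toOpenPartialHomeomorph_left_inv
    change ((e₁.symm.trans e₂) _).1 = _
    rw [OpenPartialHomeomorph.coe_trans, Function.comp_apply, this, projLattice_torusLattice]
    rfl

end

/-- The torus bundles for different indices are isomorphic. -/
theorem exists_homeomorph {n n' : ℕ} (hn : 1 ≤ n) (hn' : 1 ≤ n') :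
    ∃ f : HeisenbergLattice n ≃ₜ HeisenbergLattice n',
      ∀ Λ, projLattice hn' (f Λ) = projLattice hn Λ := by
  have hmap : ∀ {n n' : ℕ} (hn : 1 ≤ n) (hn' : 1 ≤ n'),
      ∃ f : HeisenbergLattice n → HeisenbergLattice n', Continuous f ∧
        ∀ x, f (angleLattice hn x) = angleLattice hn' x := by
    intro n n' hn hn'
    let f : HeisenbergLattice n → HeisenbergLattice n' := fun Λ =>
      angleLattice hn' (Function.surjInv (angleLattice_surjective hn) Λ)
    have hf : ∀ x, f (angleLattice hn x) = angleLattice hn' x := fun x =>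
      (angleLattice_eq_iff hn').2 ((angleLattice_eq_iff hn).1 (Function.surjInv_eq _ _))
    refine ⟨f, ?_, hf⟩
    rw [(isQuotientMap_angleLattice hn).continuous_iff]
    exact (continuous_angleLattice hn').congr fun x => (hf x).symm
  obtain ⟨f, hfc, hf⟩ := hmap hn hn'
  obtain ⟨g, hgc, hg⟩ := hmap hn' hn
  refine ⟨⟨⟨f, g, fun Λ => ?_, fun Λ => ?_⟩, hfc, hgc⟩, fun Λ => ?_⟩
  · obtain ⟨x, rfl⟩ := angleLattice_surjective hn Λ
    rw [hf, hg]
  · obtain ⟨x, rfl⟩ := angleLattice_surjective hn' Λ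
    rw [hg, hf]
  · obtain ⟨x, rfl⟩ := angleLattice_surjective hn Λ
    change projLattice hn' (f _) = _
    rw [hf, projLattice_angleLattice, projLattice_angleLattice]

end Heisenberg

theorem proposition9 :
    -- `Aut(H)` is a Lie group of dimension 6
    (∃ _ : ChartedSpace (EuclideanSpace ℝ (Fin 6)) (Heisenberg ≃ₜ* Heisenberg),
      LieGroup (𝓡 6) ∞ (Heisenberg ≃ₜ* Heisenberg)) ∧
    -- the maps `π n : L_n(H) → L(ℂ)`, `Λ ↦ p(Λ)`
    ∃ π : ∀ n : ℕ, 1 ≤ n → HeisenbergLattice n → ComplexLattice,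
      (∀ (n : ℕ) (hn : 1 ≤ n) (Λ : HeisenbergLattice n),
        ((π n hn Λ).1 : Set ℂ) = Heisenberg.z '' (Λ.1 : Set Heisenberg)) ∧
      -- they are torus bundles
      (∀ (n : ℕ) (hn : 1 ≤ n), IsTorusBundle (π n hn)) ∧
      -- `L_n(H)` is, via `φ ↦ φ(Λ₀)`, the quotient of `Aut(H)` by a discrete subgroup
      (∀ n : ℕ, 1 ≤ n → Nonempty (HeisenbergLattice n) ∧
        ∀ Λ₀ : HeisenbergLattice n,
          DiscreteTopology (MulAction.stabilizer (Heisenberg ≃ₜ* Heisenberg) Λ₀.1) ∧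
          ∃ e : ((Heisenberg ≃ₜ* Heisenberg) ⧸
                MulAction.stabilizer (Heisenberg ≃ₜ* Heisenberg) Λ₀.1) ≃ₜ HeisenbergLattice n,
            ∀ φ : Heisenberg ≃ₜ* Heisenberg,
              (e (QuotientGroup.mk φ)).1 = φ • Λ₀.1) ∧
      -- the spaces are homeomorphic, and the bundles isomorphic, for different `n`
      (∀ (n n' : ℕ) (hn : 1 ≤ n) (hn' : 1 ≤ n'),
        Nonempty (HeisenbergLattice n ≃ₜ HeisenbergLattice n') ∧
        ∃ f : HeisenbergLattice n ≃ₜ HeisenbergLattice n',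
          ∀ Λ : HeisenbergLattice n, π n' hn' (f Λ) = π n hn Λ) := by
  refine ⟨⟨autChartedSpace, lieGroup_aut⟩, fun _ hn => projLattice hn,
    fun _ hn => coe_projLattice hn, fun _ hn => isTorusBundle_projLattice hn, fun n hn => ⟨?_, ?_⟩,
    fun n n' hn hn' => ?_⟩
  · exact ⟨toLattice hn (⟨(Complex.I, 1), by simp [area]⟩, 0, 0)⟩
  · exact fun Λ₀ => ⟨discreteTopology_stabilizer Λ₀ hn, exists_homeomorph_quotient hn Λ₀⟩
  · obtain ⟨f, hf⟩ := exists_homeomorph hn hn'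
    exact ⟨⟨f⟩, f, hf⟩
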